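/- Let $q\in L^\infty(0,1)$ be real-valued and let $\mathcal L=-\frac{d^2}{dx^2}+q$ be the Sturm–Liouville operator on (complex-valued) $L^2(0,1)$ with Dirichlet conditions, with domain the set of $y\in C^1[0,1]$ such that $y'$ is absolutely continuous, $y''\in L^2(0,1)$ and $y(0)=y(1)=0$. Assume that all eigenvalues of $\mathcal L$ are positive. Definitions. The test space is $C^\infty_{\mathcal L}=\bigcap_{m}\mathrm{Dom}(\mathcal L^m)$ with the norms $\max_{j\le m}\|\mathcal L^j\phi\|_{L^2}$ $(m\in\mathbb N_0)$, and $\mathcal D'_{\mathcal L}$ is the space of continuous linear functionals on it; $f\in L^2(0,1)$ is identified with the functional $\phi\mapsto\int_0^1 f\phi\,dx$. For $r\in\mathbb R$, $\mathcal L^r\omega\in\mathcal D'_{\mathcal L}$ is determined by $\langle\mathcal L^r\omega,e\rangle=\lambda^r\langle\omega,e\rangle$ for every eigenfunction $e$ of $\mathcal L$ with eigenvalue $\lambda$. For $s\in\mathbb R$, $W^s_{\mathcal L}=\{\omega\in\mathcal D'_{\mathcal L}:\mathcal L^{s/2}\omega\in L^2(0,1)\}$ with $\|\omega\|_{W^s_{\mathcal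 L}}=\|\mathcal L^{s/2}\omega\|_{L^2}$. Theorem. Let $s\ge 0$, $T>0$, $u_0\in W^s_{\mathcal L}$, $u_1\in L^2(0,1)$. The problem $$u_{tt}+\mathcal L^s u=0\ \text{ on }[0,T]\times(0,1),\qquad u(0,\cdot)=u_0,\quad u_t(0,\cdot)=u_1,\qquad u(t,0)=u(t,1)=0,$$ has a unique solution $u\in C([0,T],W^s_{\mathcal L})\cap C^1([0,T],L^2(0,1))$. Here the equation means that $\frac{d}{dt}\langle u_t(t),\phi\rangle=-\langle\mathcal L^su(t),\phi\rangle$ for all $t\in[0,T]$ and $\phi\in C^\infty_{\mathcal L}$; the boundary condition means that, if $s>\frac12$, each $u(t)$ has a continuous representative on $[0,1]$ vanishing at $0$ and $1$, while for $s\le\frac12$ it is expressed only through the domain of $\mathcal L$. The eigenvalues of $\mathcal L$ form a strictly increasing sequence $(\lambda_n)_{n\ge1}$ with corresponding real-valued $L^2$-normalized eigenfunctions $\phi_n$, and for every such choice, with $A_n=\langle u_0,\phi_n\rangle$ and $B_n=\int_0^1u_1\phi_n\,dx$, $$u(t)=\sum_{n\ge1}\Big[A_n\cos\big(\sqrt{\lambda_n^s}\,t\big)+\tfrac{1}{\sqrt{\lambda_n^s}}B_n\sin\big(\sqrt{\lambda_n^s}\,t\big)\Big]\phi_n\quad\text{in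 }L^2(0,1),\ t\in[0,T].$$ Moreover, for all $t\in[0,T]$, $$\|u(t)\|_{L^2}\le C\big(\|u_0\|_{L^2}+\|u_1\|_{W^{-s}_{\mathcal L}}\big),\quad \|u(t)\|_{W^s_{\mathcal L}}\le C\big(\|u_0\|_{W^s_{\mathcal L}}+\|u_1\|_{L^2}\big),\quad \|u_t(t)\|_{L^2}\le C\big(\|u_0\|_{W^s_{\mathcal L}}+\|u_1\|_{L^2}\big),$$ where $C>0$ depends at most on $s$ and $T$; it is independent of $u_0$, $u_1$, $q$ and $t$. -/

import Mathlib

open MeasureTheory Set Filter Topology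
open scoped ENNReal

namespace SturmLiouville

noncomputable section

/-- Lebesgue measure on the interval `(0,1)`. -/
abbrev mu01 : Measure ℝ := volume.restrict (Ioo (0 : ℝ) 1)

/-- The complex Hilbert space `L²(0,1)`. -/
abbrev L2 : Type := Lp ℂ 2 mu01

/-- `p = (f, g)` with `f` in the Dirichlet domain of `𝓛 = -d²/dx² + q` and `g = 𝓛 f`:
`f` has a representative `y` that is differentiable on `[0,1]`, vanishes at `0` and `1`, and whose
derivative `y'` is absolutely continuous with density `y'' = h ∈ L²(0,1)`; and `g = -h + q y`. -/
def IsGraphPoint (q : ℝ → ℝ) (p : L2 × L2) : Prop :=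
  ∃ (y y' : ℝ → ℂ) (h : L2),
    y 0 = 0 ∧ y 1 = 0 ∧
    (∀ x ∈ Icc (0 : ℝ) 1, HasDerivWithinAt y (y' x) (Icc (0 : ℝ) 1) x) ∧
    (∀ x ∈ Icc (0 : ℝ) 1, y' x = y' 0 + ∫ t in (0 : ℝ)..x, h t) ∧
    (p.1 : ℝ → ℂ) =ᵐ[mu01] y ∧
    (p.2 : ℝ → ℂ) =ᵐ[mu01] fun x => -h x + (q x : ℂ) * y x

theorem intervalIntegrable_L2 (h : L2) {x : ℝ} (hx : x ∈ Icc (0 : ℝ) 1) :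
    IntervalIntegrable (h : ℝ → ℂ) volume 0 x := by
  rw [intervalIntegrable_iff_integrableOn_Ioo_of_le hx.1]
  have h1 : Integrable (h : ℝ → ℂ) mu01 := (Lp.memLp h).integrable (by norm_num)
  exact IntegrableOn.mono_set h1 (Ioo_subset_Ioo_right hx.2)

theorem intervalIntegral_congr_L2 {f g : ℝ → ℂ} (hfg : f =ᵐ[mu01] g) {x : ℝ}
    (hx : x ∈ Icc (0 : ℝ) 1) : ∫ t in (0 : ℝ)..x, f t = ∫ t in (0 : ℝ)..x, g t := by
  rw [intervalIntegral.integral_of_le hx.1, intervalIntegral.integral_of_le hx.1,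
    integral_Ioc_eq_integral_Ioo, integral_Ioc_eq_integral_Ioo]
  exact integral_congr_ae (ae_restrict_of_ae_restrict_of_subset (Ioo_subset_Ioo_right hx.2) hfg)

/-- The graph of the Dirichlet Sturm–Liouville operator. -/
def slGraph (q : ℝ → ℝ) : Submodule ℂ (L2 × L2) where
  carrier := {p | IsGraphPoint q p}
  zero_mem' := by
    refine ⟨0, 0, 0, rfl, rfl, fun x _ => ?_, fun x hx => ?_, ?_, ?_⟩
    · exact hasDerivWithinAt_const x _ (0 : ℂ)
    · rw [intervalIntegral_congr_L2 (Lp.coeFn_zero ℂ 2 mu01) hx]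
      simp
    · exact Lp.coeFn_zero ℂ 2 mu01
    · filter_upwards [Lp.coeFn_zero ℂ 2 mu01] with x hx
      change (0 : L2) x = -(0 : L2) x + (q x : ℂ) * 0
      rw [hx]
      simp
  add_mem' := by
    rintro p r ⟨y, y', h, h0, h1, hd, hi, hf, hg⟩ ⟨z, z', k, k0, k1, kd, ki, kf, kg⟩
    refine ⟨y + z, y' + z', h + k, by simp [h0, k0], by simp [h1, k1],
      fun x hx => (hd x hx).add (kd x hx), fun x hx => ?_, ?_, ?_⟩
    · rw [intervalIntegral_congr_L2 (Lp.coeFn_add h k) hx]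
      simp only [Pi.add_apply]
      rw [intervalIntegral.integral_add (intervalIntegrable_L2 h hx) (intervalIntegrable_L2 k hx),
        hi x hx, ki x hx]
      ring
    · filter_upwards [hf, kf, Lp.coeFn_add p.1 r.1] with x a b c
      simp only [Prod.fst_add, Pi.add_apply] at *
      rw [c, a, b]
    · filter_upwards [hg, kg, Lp.coeFn_add p.2 r.2, Lp.coeFn_add h k] with x a b c d
      simp only [Prod.snd_add, Pi.add_apply] at *
      rw [c, a, b, d]
      ring
  smul_mem' := by
    rintro c p ⟨y, y', h, h0, h1, hd, hi, hf, hg⟩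
    refine ⟨c • y, c • y', c • h, by simp [h0], by simp [h1],
      fun x hx => (hd x hx).const_smul c, fun x hx => ?_, ?_, ?_⟩
    · rw [intervalIntegral_congr_L2 (Lp.coeFn_smul c h) hx]
      simp only [Pi.smul_apply, intervalIntegral.integral_smul]
      rw [hi x hx, smul_add]
    · filter_upwards [hf, Lp.coeFn_smul c p.1] with x a b
      simp only [Prod.smul_fst, Pi.smul_apply] at *
      rw [b, a]
    · filter_upwards [hg, Lp.coeFn_smul c p.2, Lp.coeFn_smul c h] with x a b d
      simp only [Prod.smul_snd, Pi.smul_apply, smul_eq_mul] at *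
      rw [b, a, d]
      ring

/-- The graph is single-valued, so it is the graph of an operator. -/
theorem slGraph_functional (q : ℝ → ℝ) (p : L2 × L2) (hp : p ∈ slGraph q) (h0 : p.1 = 0) :
    p.2 = 0 := by
  obtain ⟨y, y', h, -, -, hd, hi, hf, hg⟩ := hp
  have hcont : ContinuousOn y (Icc 0 1) := fun x hx => (hd x hx).continuousWithinAt
  have hy0 : ∀ᵐ x ∂mu01, y x = 0 := by
    rw [h0] at hf
    filter_upwards [hf, Lp.coeFn_zero ℂ 2 mu01] with x a b
    rw [← a, b]; rfl
  have hyoo : EqOn y 0 (Ioo 0 1) :=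
    Measure.eqOn_open_of_ae_eq hy0 isOpen_Ioo (hcont.mono Ioo_subset_Icc_self)
      continuousOn_const
  have hycc : EqOn y 0 (Icc 0 1) := by
    have hcl : Icc (0 : ℝ) 1 ⊆ closure (Ioo 0 1) := by
      rw [closure_Ioo (by norm_num)]
    exact hyoo.of_subset_closure hcont continuousOn_const Ioo_subset_Icc_self hcl
  have hy' : ∀ x ∈ Icc (0 : ℝ) 1, y' x = 0 := fun x hx => by
    have h1 : HasDerivWithinAt (fun _ : ℝ => (0 : ℂ)) (y' x) (Icc 0 1) x :=
      (hd x hx).congr (fun t ht => (hycc ht).symm) (hycc hx).symm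
    exact (uniqueDiffOn_Icc (by norm_num : (0 : ℝ) < 1) x hx).eq_deriv _ h1
      (hasDerivWithinAt_const x _ (0 : ℂ))
  have hint : ∀ x ∈ Icc (0 : ℝ) 1, ∫ t in (0 : ℝ)..x, h t = 0 := fun x hx => by
    have := hi x hx
    rw [hy' x hx, hy' 0 (by simp)] at this
    simpa using this.symm
  have hh : ∀ᵐ x ∂mu01, h x = 0 := by
    have hloc := (intervalIntegrable_L2 h (x := 1) (by simp)).ae_hasDerivAt_integral
    rw [ae_restrict_iff' measurableSet_Ioo]
    filter_upwards [hloc] with x hx hxm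
    have hx1 := hx (by rw [uIcc_of_le (by norm_num)]; exact Ioo_subset_Icc_self hxm) 0 (by simp)
    have hx2 : HasDerivAt (fun _ : ℝ => (0 : ℂ)) (h x) x :=
      hx1.congr_of_eventuallyEq (by
        filter_upwards [Ioo_mem_nhds hxm.1 hxm.2] with t ht
        exact (hint t (Ioo_subset_Icc_self ht)).symm)
    exact hx2.unique (hasDerivAt_const x (0 : ℂ))
  apply (Lp.eq_zero_iff_ae_eq_zero).2
  filter_upwards [hg, hh, hy0] with x a b c
  rw [a, b, c]; simp

/-- The Sturm–Liouville operator `𝓛 = -d²/dx² + q` on `L²(0,1)` with Dirichlet boundary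
conditions, as an unbounded operator. -/
def slOperator (q : ℝ → ℝ) : L2 →ₗ.[ℂ] L2 := (slGraph q).toLinearPMap

theorem slOperator_graph (q : ℝ → ℝ) : (slOperator q).graph = slGraph q :=
  Submodule.toLinearPMap_graph_eq _ (fun p hp h => slGraph_functional q p hp h)

open Classical in
/-- `f ↦ 𝓛 f`, extended by `0` off the domain so that it can be iterated. -/
def slApply (q : ℝ → ℝ) (f : L2) : L2 :=
  if h : f ∈ (slOperator q).domain then slOperator q ⟨f, h⟩ else 0

theorem slApply_add (q : ℝ → ℝ) {f g : L2} (hf : f ∈ (slOperator q).domain)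
    (hg : g ∈ (slOperator q).domain) : slApply q (f + g) = slApply q f + slApply q g := by
  simp only [slApply, hf, hg, Submodule.add_mem _ hf hg, dif_pos]
  exact (slOperator q).map_add ⟨f, hf⟩ ⟨g, hg⟩

theorem slApply_smul (q : ℝ → ℝ) (c : ℂ) {f : L2} (hf : f ∈ (slOperator q).domain) :
    slApply q (c • f) = c • slApply q f := by
  simp only [slApply, hf, Submodule.smul_mem _ c hf, dif_pos]
  exact (slOperator q).map_smul c ⟨f, hf⟩

theorem slApply_iterate_add (q : ℝ → ℝ) {f g : L2}
    (hf : ∀ j : ℕ, (slApply q)^[j] f ∈ (slOperator q).domain)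
    (hg : ∀ j : ℕ, (slApply q)^[j] g ∈ (slOperator q).domain) (j : ℕ) :
    (slApply q)^[j] (f + g) = (slApply q)^[j] f + (slApply q)^[j] g := by
  induction j with
  | zero => rfl
  | succ j ih =>
    simp only [Function.iterate_succ_apply']
    rw [ih, slApply_add q (hf j) (hg j)]

theorem slApply_iterate_smul (q : ℝ → ℝ) (c : ℂ) {f : L2}
    (hf : ∀ j : ℕ, (slApply q)^[j] f ∈ (slOperator q).domain) (j : ℕ) :
    (slApply q)^[j] (c • f) = c • (slApply q)^[j] f := by
  induction j with
  | zero => rfl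
  | succ j ih =>
    simp only [Function.iterate_succ_apply']
    rw [ih, slApply_smul q c (hf j)]

/-- The space of test functions `C^∞_𝓛(0,1) = Dom(𝓛^∞)`: all `f ∈ L²(0,1)` such that
`𝓛^j f ∈ Dom(𝓛)` for every `j`. -/
def testSpace (q : ℝ → ℝ) : Submodule ℂ L2 where
  carrier := {f | ∀ j : ℕ, (slApply q)^[j] f ∈ (slOperator q).domain}
  zero_mem' := by
    intro j
    have : (slApply q)^[j] (0 : L2) = 0 := by
      induction j with
      | zero => rfl
      | succ j ih =>
        rw [Function.iterate_succ_apply', ih]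
        simpa using slApply_smul q 0 (Submodule.zero_mem (slOperator q).domain)
    rw [this]
    exact Submodule.zero_mem _
  add_mem' := by
    intro f g hf hg j
    rw [slApply_iterate_add q hf hg j]
    exact Submodule.add_mem _ (hf j) (hg j)
  smul_mem' := by
    intro c f hf j
    rw [slApply_iterate_smul q c hf j]
    exact Submodule.smul_mem _ c (hf j)

/-- The norms `‖φ‖_{C^m_𝓛} = max_{j ≤ m} ‖𝓛^j φ‖_{L²}` defining the Fréchet topology of
the space of test functions. -/
def testNorm (q : ℝ → ℝ) (m : ℕ) (φ : testSpace q) : ℝ :=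
  (Finset.range (m + 1)).sup' Finset.nonempty_range_add_one
    (fun j => ‖(slApply q)^[j] (φ : L2)‖)

theorem testNorm_mono (q : ℝ → ℝ) {m n : ℕ} (h : m ≤ n) (φ : testSpace q) :
    testNorm q m φ ≤ testNorm q n φ :=
  Finset.sup'_mono _ (by intro j; simp only [Finset.mem_range]; omega) _

theorem testNorm_nonneg (q : ℝ → ℝ) (m : ℕ) (φ : testSpace q) : 0 ≤ testNorm q m φ :=
  (norm_nonneg _).trans (Finset.le_sup' (fun j => ‖(slApply q)^[j] (φ : L2)‖)
    (Finset.mem_range.2 (Nat.succ_pos m)))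

/-- The space `𝓓'_𝓛(0,1)` of `𝓛`-distributions: the linear functionals on the space of test
functions that are continuous, i.e. bounded by a multiple of one of the (increasing) norms
`‖·‖_{C^m_𝓛}`. -/
def LDistribution (q : ℝ → ℝ) : Submodule ℂ (Module.Dual ℂ (testSpace q)) where
  carrier := {ω | ∃ (C : ℝ) (m : ℕ), 0 ≤ C ∧ ∀ φ : testSpace q, ‖ω φ‖ ≤ C * testNorm q m φ}
  zero_mem' := ⟨0, 0, le_rfl, fun φ => by simp⟩
  add_mem' := by
    rintro ω η ⟨C, m, hC, h⟩ ⟨D, n, hD, k⟩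
    refine ⟨C + D, max m n, add_nonneg hC hD, fun φ => ?_⟩
    have h1 := mul_le_mul_of_nonneg_left (testNorm_mono q (le_max_left m n) φ) hC
    have h2 := mul_le_mul_of_nonneg_left (testNorm_mono q (le_max_right m n) φ) hD
    calc ‖(ω + η) φ‖ ≤ ‖ω φ‖ + ‖η φ‖ := norm_add_le _ _
      _ ≤ (C + D) * testNorm q (max m n) φ := by linarith [h φ, k φ]
  smul_mem' := by
    rintro c ω ⟨C, m, hC, h⟩
    refine ⟨‖c‖ * C, m, by positivity, fun φ => ?_⟩
    rw [LinearMap.smul_apply, norm_smul, mul_assoc]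
    exact mul_le_mul_of_nonneg_left (h φ) (norm_nonneg c)

theorem integrable_mul_L2 (f g : L2) : Integrable (fun x => f x * g x) mu01 :=
  MemLp.integrable_mul (Lp.memLp f) (Lp.memLp g)

theorem norm_integral_mul_le (f g : L2) : ‖∫ x in Ioo (0 : ℝ) 1, f x * g x‖ ≤ ‖f‖ * ‖g‖ := by
  have h1 : ∫ x in Ioo (0 : ℝ) 1, f x * g x = inner ℂ (star f) g := by
    rw [L2.inner_def]
    apply integral_congr_ae
    filter_upwards [Lp.coeFn_star f] with x hx
    rw [hx]
    simp [mul_comm]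
  have h2 : ‖star f‖ = ‖f‖ := by
    rw [Lp.norm_def, Lp.norm_def]
    congr 1
    apply eLpNorm_congr_norm_ae
    filter_upwards [Lp.coeFn_star f] with x hx
    rw [hx]
    simp
  rw [h1, ← h2]
  exact norm_inner_le_norm (𝕜 := ℂ) (star f) g

/-- The embedding of `L²(0,1)` into the `𝓛`-distributions, `f ↦ (φ ↦ ∫₀¹ f φ dx)`. -/
def ofL2 (q : ℝ → ℝ) (f : L2) : LDistribution q :=
  ⟨{ toFun := fun φ => ∫ x in Ioo (0 : ℝ) 1, f x * (φ : L2) x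
     map_add' := fun φ ψ => by
      rw [← integral_add (integrable_mul_L2 f φ) (integrable_mul_L2 f ψ)]
      apply integral_congr_ae
      filter_upwards [Lp.coeFn_add (φ : L2) (ψ : L2)] with x hx
      rw [Submodule.coe_add, hx, Pi.add_apply, mul_add]
     map_smul' := fun c φ => by
      rw [RingHom.id_apply, ← integral_smul]
      apply integral_congr_ae
      filter_upwards [Lp.coeFn_smul c (φ : L2)] with x hx
      rw [Submodule.coe_smul, hx, Pi.smul_apply, smul_eq_mul, smul_eq_mul]
      ring },
    ⟨‖f‖, 0, norm_nonneg f, fun φ => by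
      simpa [testNorm] using norm_integral_mul_le f (φ : L2)⟩⟩

/-- `e` is an eigenfunction of `𝓛` with Dirichlet boundary conditions and eigenvalue `lam`. -/
def IsEigenpair (q : ℝ → ℝ) (lam : ℝ) (e : L2) : Prop :=
  e ≠ 0 ∧ ∃ h : e ∈ (slOperator q).domain, slOperator q ⟨e, h⟩ = (lam : ℂ) • e

/-- `lam` is an eigenvalue of `𝓛` with Dirichlet boundary conditions. -/
def IsEigenvalue (q : ℝ → ℝ) (lam : ℝ) : Prop := ∃ e : L2, IsEigenpair q lam e

/-- `lam 0 < lam 1 < …` are all the eigenvalues of `𝓛`, and `φ 0, φ 1, …` are corresponding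
real-valued eigenfunctions, normalised in `L²(0,1)`. -/
structure IsEigensystem (q : ℝ → ℝ) (lam : ℕ → ℝ) (φ : ℕ → testSpace q) : Prop where
  strictMono : StrictMono lam
  eigenpair : ∀ n, IsEigenpair q (lam n) (φ n)
  exhaustive : ∀ l : ℝ, IsEigenvalue q l → ∃ n, l = lam n
  normalized : ∀ n, ‖(φ n : L2)‖ = 1
  real_valued : ∀ n, ∀ᵐ x ∂mu01, ((φ n : L2) x).im = 0

/-- `η = 𝓛^r ω`: multiplication by `λ^r` on every eigenfunction with eigenvalue `λ`. -/
def IsFracPow (q : ℝ → ℝ) (r : ℝ) (ω η : LDistribution q) : Prop :=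
  ∀ (lam : ℝ) (e : testSpace q), IsEigenpair q lam e → η.1 e = ((lam ^ r : ℝ) : ℂ) * ω.1 e

open Classical in
/-- The fractional power `𝓛^r` acting on `𝓛`-distributions. -/
def fracPow (q : ℝ → ℝ) (r : ℝ) (ω : LDistribution q) : LDistribution q :=
  if h : ∃ η : LDistribution q, IsFracPow q r ω η then h.choose else 0

open Classical in
/-- The `L²(0,1)` norm of an `𝓛`-distribution which is (given by) a function in `L²(0,1)`. -/
def l2Norm (q : ℝ → ℝ) (ω : LDistribution q) : ℝ :=
  if h : ∃ f : L2, ofL2 q f = ω then ‖h.choose‖ else 0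

/-- The Sobolev space `W^s_𝓛(0,1) = {ω ∈ 𝓓'_𝓛(0,1) : 𝓛^{s/2} ω ∈ L²(0,1)}`. -/
def sobolevSpace (q : ℝ → ℝ) (s : ℝ) : Set (LDistribution q) :=
  {ω | ∃ f : L2, ofL2 q f = fracPow q (s / 2) ω}

/-- The norm `‖ω‖_{W^s_𝓛} = ‖𝓛^{s/2} ω‖_{L²}`. -/
def sobolevNorm (q : ℝ → ℝ) (s : ℝ) (ω : LDistribution q) : ℝ :=
  l2Norm q (fracPow q (s / 2) ω)

/-- The time derivative on `[0,T]` (one-sided at the end points) of an `L²(0,1)`-valued map. -/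
def timeDeriv (T : ℝ) (u : ℝ → L2) (t : ℝ) : L2 := derivWithin u (Icc 0 T) t

/-- `u ∈ C([0,T], W^s_𝓛) ∩ C¹([0,T], L²)` solves `u_tt + 𝓛^s u = 0` with initial data
`u(0) = u₀`, `u_t(0) = u₁` and Dirichlet boundary conditions. -/
structure IsSolution (q : ℝ → ℝ) (s T : ℝ) (u₀ : LDistribution q) (u₁ : L2) (u : ℝ → L2) :
    Prop where
  mem_sobolev : ∀ t ∈ Icc 0 T, ofL2 q (u t) ∈ sobolevSpace q s
  continuous_sobolev : ∀ t ∈ Icc 0 T,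
    Tendsto (fun τ => sobolevNorm q s (ofL2 q (u τ) - ofL2 q (u t))) (𝓝[Icc 0 T] t) (𝓝 0)
  contDiff_L2 : ContDiffOn ℝ 1 u (Icc 0 T)
  /-- The equation holds in `𝓓'_𝓛(0,1)` at every time: `(d/dt) ⟨u_t, φ⟩ = -⟨𝓛^s u, φ⟩`. -/
  equation : ∀ φ : testSpace q, ∀ t ∈ Icc 0 T,
    HasDerivWithinAt (fun τ => (ofL2 q (timeDeriv T u τ)).1 φ)
      (-((fracPow q s (ofL2 q (u t))).1 φ)) (Icc 0 T) t
  initial : ofL2 q (u 0) = u₀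
  initial_deriv : timeDeriv T u 0 = u₁
  /-- `u(t,0) = u(t,1) = 0` pointwise whenever the traces exist (`s > 1/2`); for smaller `s` the
  boundary conditions are those in the domain of `𝓛` defining the spaces and the powers. -/
  boundary : 1 / 2 < s → ∀ t ∈ Icc 0 T, ∃ y : ℝ → ℂ,
    ContinuousOn y (Icc 0 1) ∧ (u t : ℝ → ℂ) =ᵐ[mu01] y ∧ y 0 = 0 ∧ y 1 = 0

end

end SturmLiouville

namespace SturmLiouville

/-! The proof diagonalises `𝓛` and solves one harmonic oscillator per eigenvalue. Integrating `-y''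
= F` twice gives a compact symmetric operator `green`, and the graph of `𝓛` becomes the equation `f
= green (g - q f)` (`mem_slGraph_iff`). Since `0` is not an eigenvalue, the Fredholm alternative
turns this into a compact symmetric inverse of `𝓛` (`exists_compact_inverse`). The spectral theorem
then gives completeness of the eigenfunctions, compactness gives finitely many eigenvalues below
each level, and uniqueness for the initial value problem gives simplicity; so the eigenvalues can be
listed increasingly (`exists_eigensystem`).

A distribution is determined by its values on the eigenfunctions (`hasSum_distribution`). These
values are, after division by a power of `1 + λ`, square summable (`exists_representative`), which
is what makes every `𝓛^r ω` exist (`exists_isFracPow`).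

Tested on an eigenfunction, the equation reads `z'' = -λ^s z`. Two conserved quantities of the
oscillator give uniqueness (`oscillator_unique`). For existence, the coefficients of `u`, `u_t` and
`𝓛^(s/2) u` are sines and cosines times fixed square summable sequences (`exists_multiplier`). As
these multipliers are at most `1` in absolute value, the three estimates hold with `C = 1`.

The boundary values for `s > 1/2` need no eigenvalue asymptotics. The expansion is cut into dyadic
blocks `λ ~ 2^k`. Interpolating the sup norm between `‖y‖` and `‖y'‖` costs a factor `2^(k/4)` on a
block, membership in `W^s` gains `2^(-ks/2)`, and the blocks sum uniformly
(`exists_boundary_representative`). -/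

/-! ### Primitives and the Volterra operator on `L²(0,1)` -/

/-- The primitive `x ↦ ∫₀ˣ f` of a function in `L²(0,1)`. -/
noncomputable def prim (f : L2) (x : ℝ) : ℂ := ∫ t in (0 : ℝ)..x, f t

/-- The indicator function of a measurable set, as an element of `L²(0,1)`. -/
noncomputable def ind {s : Set ℝ} (hs : MeasurableSet s) : L2 :=
  indicatorConstLp 2 hs (measure_ne_top mu01 s) (1 : ℂ)

/-- In this form the Hölder bound for primitives is Cauchy–Schwarz, and freezing the primitive at a
grid point is a bounded functional, as the step approximations require. -/
theorem prim_sub_eq_inner (f : L2) {a b : ℝ} (ha : 0 ≤ a) (hab : a ≤ b) (hb : b ≤ 1) :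
    prim f b - prim f a = inner ℂ (ind (measurableSet_Ioo (a := a) (b := b))) f := by
  rw [ind, L2.inner_indicatorConstLp_one, prim, prim,
    intervalIntegral.integral_interval_sub_left (intervalIntegrable_L2 f ⟨ha.trans hab, hb⟩)
      (intervalIntegrable_L2 f ⟨ha, hab.trans hb⟩), intervalIntegral.integral_of_le hab,
    integral_Ioc_eq_integral_Ioo, Measure.restrict_restrict measurableSet_Ioo,
    inter_eq_left.2 (Ioo_subset_Ioo ha hb)]

theorem norm_ind_Ioo_le {a b : ℝ} (hab : a ≤ b) :
    ‖ind (measurableSet_Ioo (a := a) (b := b))‖ ≤ √(b - a) := by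
  rw [ind, norm_indicatorConstLp (by norm_num) (by norm_num), norm_one, one_mul,
    Real.sqrt_eq_rpow]
  have : mu01.real (Ioo a b) ≤ b - a := by
    calc mu01.real (Ioo a b) ≤ volume.real (Ioo a b) :=
          ENNReal.toReal_mono (by simp) (Measure.restrict_apply_le _ _)
      _ = b - a := by rw [Real.volume_real_Ioo_of_le hab]
  simp only [ENNReal.toReal_ofNat]
  exact Real.rpow_le_rpow measureReal_nonneg this (by norm_num)

theorem norm_prim_sub_le (f : L2) {a b : ℝ} (ha : 0 ≤ a) (hab : a ≤ b) (hb : b ≤ 1) :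
    ‖prim f b - prim f a‖ ≤ √(b - a) * ‖f‖ := by
  rw [prim_sub_eq_inner f ha hab hb]
  exact (norm_inner_le_norm _ _).trans
    (mul_le_mul_of_nonneg_right (norm_ind_Ioo_le hab) (norm_nonneg f))

@[simp] theorem prim_zero_right (f : L2) : prim f 0 = 0 := by simp [prim]

theorem norm_prim_le (f : L2) {x : ℝ} (hx : x ∈ Icc (0 : ℝ) 1) : ‖prim f x‖ ≤ ‖f‖ := by
  have h := norm_prim_sub_le f le_rfl hx.1 hx.2
  rw [prim_zero_right, sub_zero, sub_zero] at h
  exact h.trans (mul_le_of_le_one_left (norm_nonneg f) (Real.sqrt_le_one.2 hx.2))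

theorem continuousOn_prim (f : L2) : ContinuousOn (prim f) (Icc 0 1) := by
  have h := intervalIntegral.continuousOn_primitive_interval (a := 0) (b := 1) (μ := volume)
    (f := (f : ℝ → ℂ))
  rw [uIcc_of_le zero_le_one] at h
  apply h
  rw [integrableOn_Icc_iff_integrableOn_Ioo]
  exact (Lp.memLp f).integrable (by norm_num)

theorem ae_mem_Ioo : ∀ᵐ x ∂mu01, x ∈ Ioo (0 : ℝ) 1 := ae_restrict_mem measurableSet_Ioo

theorem aestronglyMeasurable_mu01_of_continuousOn {y : ℝ → ℂ} (hy : ContinuousOn y (Icc 0 1)) :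
    AEStronglyMeasurable y mu01 :=
  (hy.mono Ioo_subset_Icc_self).aestronglyMeasurable measurableSet_Ioo

theorem memLp_prim (f : L2) : MemLp (prim f) 2 mu01 := by
  refine MemLp.of_bound (aestronglyMeasurable_mu01_of_continuousOn (continuousOn_prim f)) ‖f‖ ?_
  filter_upwards [ae_mem_Ioo] with x hx
  exact norm_prim_le f (Ioo_subset_Icc_self hx)

theorem L2_norm_le_of_ae_bound {f : L2} {C : ℝ} (hC : 0 ≤ C) (h : ∀ᵐ x ∂mu01, ‖f x‖ ≤ C) :
    ‖f‖ ≤ C := by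
  have h1 := Lp.norm_le_of_ae_bound hC h
  have h2 : measureUnivNNReal mu01 = 1 := by
    simp [measureUnivNNReal, mu01]
  simpa [h2] using h1

theorem prim_add (f g : L2) {x : ℝ} (hx : x ∈ Icc (0 : ℝ) 1) :
    prim (f + g) x = prim f x + prim g x := by
  rw [prim, prim, prim, ← intervalIntegral.integral_add (intervalIntegrable_L2 f hx)
    (intervalIntegrable_L2 g hx)]
  exact intervalIntegral_congr_L2 (Lp.coeFn_add f g) hx

theorem prim_smul (c : ℂ) (f : L2) {x : ℝ} (hx : x ∈ Icc (0 : ℝ) 1) :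
    prim (c • f) x = c * prim f x := by
  rw [prim, prim, ← intervalIntegral.integral_const_mul]
  exact intervalIntegral_congr_L2 (Lp.coeFn_smul c f) hx

/-- The Volterra operator `V f (x) = ∫₀ˣ f` on `L²(0,1)`. -/
noncomputable def volterra : L2 →L[ℂ] L2 :=
  LinearMap.mkContinuous
    { toFun := fun f => (memLp_prim f).toLp (prim f)
      map_add' := fun f g => by
        rw [← MemLp.toLp_add]
        apply MemLp.toLp_congr
        filter_upwards [ae_mem_Ioo] with x hx
        exact prim_add f g (Ioo_subset_Icc_self hx)
      map_smul' := fun c f => by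
        rw [RingHom.id_apply, ← MemLp.toLp_const_smul]
        apply MemLp.toLp_congr
        filter_upwards [ae_mem_Ioo] with x hx
        exact prim_smul c f (Ioo_subset_Icc_self hx) } 1 (fun f => by
      rw [one_mul]
      refine L2_norm_le_of_ae_bound (norm_nonneg f) ?_
      filter_upwards [ae_mem_Ioo, (memLp_prim f).coeFn_toLp] with x hx h
      change ‖((memLp_prim f).toLp (prim f) : L2) x‖ ≤ _
      rw [h]
      exact norm_prim_le f (Ioo_subset_Icc_self hx))

theorem volterra_coeFn (f : L2) : volterra f =ᵐ[mu01] prim f := (memLp_prim f).coeFn_toLp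

/-- The constant function `1`. -/
noncomputable def one : L2 := ind MeasurableSet.univ

theorem one_coeFn : (one : L2) =ᵐ[mu01] fun _ => (1 : ℂ) := by
  have h := indicatorConstLp_coeFn (p := 2) (hs := MeasurableSet.univ)
    (hμs := measure_ne_top mu01 univ) (c := (1 : ℂ))
  rwa [indicator_univ] at h

theorem inner_one_left (f : L2) : inner ℂ one f = ∫ x, f x ∂mu01 := by
  rw [one, ind, L2.inner_indicatorConstLp_one, Measure.restrict_univ]

theorem prim_one_right (f : L2) : prim f 1 = inner ℂ one f := by
  rw [inner_one_left, prim, intervalIntegral.integral_of_le zero_le_one,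
    integral_Ioc_eq_integral_Ioo]

theorem inner_one_one : inner ℂ one one = (1 : ℂ) := by
  rw [inner_one_left, integral_congr_ae one_coeFn]
  simp

theorem norm_one_L2 : ‖one‖ = 1 := by
  rw [norm_eq_sqrt_re_inner (𝕜 := ℂ), inner_one_one]
  simp

theorem prim_eq_setIntegral_Iio (f : L2) {x : ℝ} (hx : x ∈ Icc (0 : ℝ) 1) :
    prim f x = ∫ t in Iio x, f t ∂mu01 := by
  have : Iio x ∩ Ioo 0 1 = Ioo 0 x := by
    ext t
    simp only [mem_inter_iff, mem_Iio, mem_Ioo]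
    constructor
    · rintro ⟨h, h0, -⟩; exact ⟨h0, h⟩
    · rintro ⟨h0, h⟩; exact ⟨h, h0, h.trans_le hx.2⟩
  rw [prim, intervalIntegral.integral_of_le hx.1, Measure.restrict_restrict measurableSet_Iio,
    integral_Ioc_eq_integral_Ioo, this]

theorem prim_eq_setIntegral_Iic (f : L2) {x : ℝ} (hx : x ∈ Icc (0 : ℝ) 1) :
    prim f x = ∫ t in Iic x, f t ∂mu01 := by
  rw [prim_eq_setIntegral_Iio f hx]
  exact setIntegral_congr_set Iio_ae_eq_Iic

/-- The Volterra operator and its adjoint add up to the rank one operator `f ↦ ∫₀¹ f`. -/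
theorem inner_volterra_add (f g : L2) :
    inner ℂ (volterra f) g + inner ℂ f (volterra g) = inner ℂ f one * inner ℂ one g := by
  have hf : Integrable (fun t => star (f t)) mu01 := by
    have := ((Lp.memLp f).integrable (by norm_num : (1 : ℝ≥0∞) ≤ 2))
    exact (LinearIsometryEquiv.integrable_comp_iff Complex.conjLIE).2 this
  have hg : Integrable (fun t => g t) mu01 := (Lp.memLp g).integrable (by norm_num)
  have hH : Integrable (fun z : ℝ × ℝ => g z.1 * star (f z.2)) (mu01.prod mu01) := hg.mul_prod hf
  have hA : MeasurableSet {z : ℝ × ℝ | z.2 < z.1} := measurableSet_lt measurable_snd measurable_fst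
  set H : ℝ × ℝ → ℂ := fun z => g z.1 * star (f z.2) with hHdef
  set A : Set (ℝ × ℝ) := {z : ℝ × ℝ | z.2 < z.1} with hAdef
  -- The two pairings integrate the same kernel `g x * conj (f t)` over the complementary regions `t
  -- < x` and `x ≤ t` of the square, so by Fubini they add up to a product of integrals.
  have h1 : inner ℂ (volterra f) g = ∫ z, A.indicator H z ∂(mu01.prod mu01) := by
    rw [integral_prod _ (hH.indicator hA), L2.inner_def]
    apply integral_congr_ae
    filter_upwards [ae_mem_Ioo, volterra_coeFn f] with x hx hv
    have : (fun t => A.indicator H (x, t)) = (Iio x).indicator (fun t => g x * star (f t)) := by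
      ext t
      simp only [indicator, hAdef, hHdef, mem_ofPred_eq, mem_Iio]
    rw [this, integral_indicator measurableSet_Iio, integral_const_mul, hv,
      prim_eq_setIntegral_Iio f (Ioo_subset_Icc_self hx)]
    simp only [RCLike.inner_apply]
    rw [← integral_conj]
    rfl
  have h2 : inner ℂ f (volterra g) = ∫ z, Aᶜ.indicator H z ∂(mu01.prod mu01) := by
    rw [integral_prod_symm _ (hH.indicator hA.compl), L2.inner_def]
    apply integral_congr_ae
    filter_upwards [ae_mem_Ioo, volterra_coeFn g] with t ht hv
    have : (fun x => Aᶜ.indicator H (x, t)) = (Iic t).indicator (fun x => g x * star (f t)) := by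
      ext x
      simp only [indicator, hAdef, hHdef, mem_ofPred_eq, mem_Iic, mem_compl_iff, not_lt]
    rw [this, integral_indicator measurableSet_Iic, integral_mul_const, hv,
      prim_eq_setIntegral_Iic g (Ioo_subset_Icc_self ht)]
    rfl
  have h3 : inner ℂ f one = ∫ t, star (f t) ∂mu01 := by
    rw [← inner_conj_symm, inner_one_left, ← integral_conj]
    rfl
  rw [h1, h2, ← integral_add (hH.indicator hA) (hH.indicator hA.compl), h3, inner_one_left,
    mul_comm, ← integral_prod_mul]
  congr 1
  ext z
  exact congrFun (indicator_self_add_compl A H) z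

/-! ### Compactness of the Volterra operator -/

/-- The step approximation of the Volterra operator on a grid of mesh `1 / N`. -/
noncomputable def volterraStep (N : ℕ) : L2 →L[ℂ] L2 :=
  ∑ i ∈ Finset.range N, (innerSL ℂ (ind (measurableSet_Ioo (a := (0 : ℝ)) (b := i / N)))).smulRight
    (ind (measurableSet_Ico (a := (i / N : ℝ)) (b := (i + 1) / N)))

theorem isCompactOperator_volterraStep (N : ℕ) : IsCompactOperator (volterraStep N) := by
  have h : volterraStep N ∈ compactOperator (RingHom.id ℂ) L2 L2 := by
    refine Submodule.sum_mem _ fun i _ => ?_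
    exact (isCompactOperator_of_locallyCompactSpace_rng (ContinuousLinearMap.toSpanSingleton ℂ
      (ind (measurableSet_Ico (a := (i / N : ℝ)) (b := (i + 1) / N))))).comp_clm
      (innerSL ℂ (ind (measurableSet_Ioo (a := (0 : ℝ)) (b := i / N))))
  exact h

/-- A point of `(0,1)` lies in exactly one cell of the grid, the one with index `⌊N x⌋₊`, so a
single term of the sum survives. -/
theorem volterraStep_ae {N : ℕ} (hN : 0 < N) (f : L2) : ∀ᵐ x ∂mu01,
    volterraStep N f x = prim f (⌊N * x⌋₊ / N) := by
  have hN' : (0 : ℝ) < N := by exact_mod_cast hN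
  have h1 : volterraStep N f = ∑ i ∈ Finset.range N, prim f (i / N) •
      ind (measurableSet_Ico (a := (i / N : ℝ)) (b := (i + 1) / N)) := by
    rw [volterraStep, sum_apply]
    refine Finset.sum_congr rfl fun i hi => ?_
    have hi' : (i : ℝ) / N ≤ 1 := by
      rw [div_le_one hN']
      exact_mod_cast (Finset.mem_range.1 hi).le
    have := prim_sub_eq_inner f le_rfl (by positivity : (0 : ℝ) ≤ i / N) hi'
    rw [prim_zero_right, sub_zero] at this
    simp [this]
  have h2 : ∀ᵐ x ∂mu01, ∀ i : ℕ, (prim f (i / N) •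
      ind (measurableSet_Ico (a := (i / N : ℝ)) (b := (i + 1) / N))) x =
      prim f (i / N) * (Ico (i / N : ℝ) ((i + 1) / N)).indicator (fun _ => 1) x := by
    rw [ae_all_iff]
    intro i
    filter_upwards [Lp.coeFn_smul (prim f (i / N))
      (ind (measurableSet_Ico (a := (i / N : ℝ)) (b := (i + 1) / N))),
      indicatorConstLp_coeFn (p := 2) (hs := measurableSet_Ico (a := (i / N : ℝ)) (b := (i + 1) / N))
        (hμs := measure_ne_top mu01 _) (c := (1 : ℂ))] with x a b
    rw [a, Pi.smul_apply, smul_eq_mul, ind, b]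
  rw [h1]
  filter_upwards [Lp.coeFn_finsetSum (Finset.range N) fun i : ℕ => prim f (i / N) •
      ind (measurableSet_Ico (a := (i / N : ℝ)) (b := (i + 1) / N)), h2, ae_mem_Ioo] with x a b hx
  have hpos : 0 ≤ N * x := mul_nonneg hN'.le hx.1.le
  have hmem : ∀ i : ℕ, x ∈ Ico (i / N : ℝ) ((i + 1) / N) ↔ ⌊N * x⌋₊ = i := by
    intro i
    rw [Nat.floor_eq_iff hpos, mem_Ico, div_le_iff₀ hN', lt_div_iff₀ hN', mul_comm x]
  have hlt : ⌊N * x⌋₊ < N := (Nat.floor_lt hpos).2 (mul_lt_of_lt_one_right hN' hx.2)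
  rw [a, Finset.sum_apply, Finset.sum_congr rfl fun i _ => b i,
    Finset.sum_eq_single_of_mem _ (Finset.mem_range.2 hlt)]
  · rw [indicator_of_mem ((hmem _).2 rfl), mul_one]
  · intro i _ hi
    rw [indicator_of_notMem (fun h => hi ((hmem i).1 h).symm), mul_zero]

/-- Primitives are Hölder of exponent `1/2`, and a point is within `1 / N` of the left end of its
cell. The resulting norm convergence passes compactness from the finite rank approximations to
`volterra`. -/
theorem norm_volterra_sub_step_le {N : ℕ} (hN : 0 < N) :
    ‖volterra - volterraStep N‖ ≤ √(1 / N) := by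
  refine ContinuousLinearMap.opNorm_le_bound _ (Real.sqrt_nonneg _) fun f => ?_
  refine L2_norm_le_of_ae_bound (by positivity) ?_
  filter_upwards [Lp.coeFn_sub (volterra f) (volterraStep N f), volterraStep_ae hN f,
    volterra_coeFn f, ae_mem_Ioo] with x h1 h2 h3 hx
  rw [sub_apply, h1, Pi.sub_apply, h2, h3]
  have hN' : (0 : ℝ) < N := by exact_mod_cast hN
  have h4 : (⌊N * x⌋₊ : ℝ) ≤ N * x := Nat.floor_le (by have := hx.1; positivity)
  have h5 : (N : ℝ) * x < ⌊N * x⌋₊ + 1 := Nat.lt_floor_add_one _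
  have h6 : (⌊N * x⌋₊ : ℝ) / N ≤ x := by rw [div_le_iff₀ hN']; linarith
  have h7 : x - (⌊N * x⌋₊ : ℝ) / N ≤ 1 / N := by
    rw [sub_le_iff_le_add, ← add_div, le_div_iff₀ hN']; linarith
  exact (norm_prim_sub_le f (by positivity) h6 hx.2.le).trans (by gcongr)

theorem isCompactOperator_volterra : IsCompactOperator volterra := by
  refine isCompactOperator_of_tendsto (F := volterraStep) (l := atTop) ?_
    (Eventually.of_forall isCompactOperator_volterraStep)
  rw [tendsto_iff_norm_sub_tendsto_zero]
  refine squeeze_zero' (Eventually.of_forall fun _ => norm_nonneg _) ?_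
    (g := fun N : ℕ => √(1 / N)) ?_
  · filter_upwards [eventually_gt_atTop 0] with N hN
    rw [norm_sub_rev]
    exact norm_volterra_sub_step_le hN
  · have := tendsto_one_div_atTop_nhds_zero_nat (𝕜 := ℝ)
    simpa [Function.comp_def] using (Real.continuous_sqrt.tendsto 0).comp this

/-! ### The Dirichlet Green operator of `-d²/dx²` -/

/-- `F ↦ y'`, where `y` solves `-y'' = F`, `y(0) = y(1) = 0`. -/
noncomputable def greenDeriv : L2 →L[ℂ] L2 :=
  ((innerSL ℂ one).comp volterra).smulRight one - volterra

theorem greenDeriv_apply (F : L2) :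
    greenDeriv F = (inner ℂ one (volterra F) : ℂ) • one - volterra F := by
  simp [greenDeriv]

/-- `F ↦ y`, where `y` solves `-y'' = F`, `y(0) = y(1) = 0`. -/
noncomputable def green : L2 →L[ℂ] L2 := volterra.comp greenDeriv

theorem green_apply (F : L2) : green F = volterra (greenDeriv F) := rfl

/-- Mean zero of `y'` is the boundary condition `y 1 = 0`. It also kills the rank one term of
`inner_volterra_add`. -/
theorem inner_one_greenDeriv (F : L2) : inner ℂ one (greenDeriv F) = 0 := by
  rw [greenDeriv_apply, inner_sub_right, inner_smul_right, inner_one_one, mul_one, sub_self]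

theorem inner_greenDeriv_one (F : L2) : inner ℂ (greenDeriv F) one = 0 := by
  rw [← inner_conj_symm, inner_one_greenDeriv, map_zero]

/-- Integration by parts: `volterra` is skew when one argument has mean zero. The symmetric right
side makes `green` self-adjoint, and `F = G` gives the Dirichlet energy. -/
theorem inner_green (F G : L2) : inner ℂ (green F) G = inner ℂ (greenDeriv F) (greenDeriv G) := by
  have h := inner_volterra_add (greenDeriv F) G
  rw [inner_greenDeriv_one, zero_mul] at h
  rw [green_apply, eq_neg_of_add_eq_zero_left h, greenDeriv_apply G, inner_sub_right,
    inner_smul_right, inner_greenDeriv_one]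
  ring

theorem inner_green_comm (F G : L2) : inner ℂ (green F) G = inner ℂ F (green G) := by
  rw [inner_green, ← inner_conj_symm F, inner_green, inner_conj_symm]

theorem isCompactOperator_green : IsCompactOperator green :=
  isCompactOperator_volterra.comp_clm greenDeriv

/-- The primitive of `w` at `x` differs from its values on a window of length `δ` around `x` by at
most `√δ * ‖w‖`, while its integral over the window is an increment of a second primitive, hence at
most `√δ * ‖volterra w‖`. The parameter `δ` is left free so that the two terms can be balanced. -/
theorem norm_prim_le_interpolation (w : L2) {x δ : ℝ} (hx : x ∈ Icc (0 : ℝ) 1) (hδ : 0 < δ)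
    (hδ1 : δ ≤ 1) : δ * ‖prim w x‖ ≤ √δ * ‖volterra w‖ + δ * (√δ * ‖w‖) := by
  -- The window `[a, a + δ]` must stay in `[0,1]`: it ends at `x` if there is room to the left, and
  -- otherwise starts at `0`.
  obtain ⟨a, ha, hb, hax, hxb⟩ : ∃ a, 0 ≤ a ∧ a + δ ≤ 1 ∧ a ≤ x ∧ x ≤ a + δ := by
    rcases le_total δ x with h | h
    · exact ⟨x - δ, by linarith, by linarith [hx.2], by linarith, by linarith⟩
    · exact ⟨0, le_rfl, by linarith, hx.1, by linarith⟩
  have hab : a ≤ a + δ := by linarith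
  have hint : IntervalIntegrable (prim w) volume a (a + δ) :=
    ((continuousOn_prim w).mono (by
      rw [uIcc_of_le hab]; exact Icc_subset_Icc ha hb)).intervalIntegrable
  have h1 : ∫ t in a..(a + δ), prim w t = prim (volterra w) (a + δ) - prim (volterra w) a := by
    have h : ∀ x ∈ Icc (0 : ℝ) 1, prim (volterra w) x = ∫ t in (0 : ℝ)..x, prim w t := fun x hx =>
      intervalIntegral_congr_L2 (volterra_coeFn w) hx
    have hi : ∀ x ∈ Icc (0 : ℝ) 1, IntervalIntegrable (prim w) volume 0 x := fun x hx =>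
      ((continuousOn_prim w).mono (by
        rw [uIcc_of_le hx.1]; exact Icc_subset_Icc le_rfl hx.2)).intervalIntegrable
    rw [h _ ⟨by linarith, hb⟩, h _ ⟨ha, by linarith⟩,
      intervalIntegral.integral_interval_sub_left (hi _ ⟨by linarith, hb⟩) (hi _ ⟨ha, by linarith⟩)]
  have h2 : ‖∫ t in a..(a + δ), (prim w x - prim w t)‖ ≤ (√δ * ‖w‖) * |a + δ - a| := by
    refine intervalIntegral.norm_integral_le_of_norm_le_const fun t ht => ?_
    rw [uIoc_of_le hab] at ht
    have ht0 : 0 ≤ t := ha.trans ht.1.le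
    have ht1 : t ≤ 1 := ht.2.trans hb
    rcases le_total t x with h | h
    · exact (norm_prim_sub_le w ht0 h hx.2).trans (by gcongr; linarith [ht.1])
    · rw [norm_sub_rev]
      exact (norm_prim_sub_le w hx.1 h ht1).trans (by gcongr; linarith [ht.2])
  rw [intervalIntegral.integral_sub intervalIntegrable_const hint, h1,
    intervalIntegral.integral_const, add_sub_cancel_left, abs_of_pos hδ] at h2
  have h3 := norm_prim_sub_le (volterra w) ha hab hb
  rw [add_sub_cancel_left] at h3
  have h4 : δ * ‖prim w x‖ = ‖δ • prim w x‖ := by rw [norm_smul, Real.norm_of_nonneg hδ.le]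
  have h5 := norm_sub_norm_le (δ • prim w x)
    (prim (volterra w) (a + δ) - prim (volterra w) a)
  rw [h4]
  linarith

theorem hasDerivWithinAt_prim {f : L2} {w : ℝ → ℂ} (hw : ContinuousOn w (Icc 0 1))
    (h : f =ᵐ[mu01] w) {x : ℝ} (hx : x ∈ Icc (0 : ℝ) 1) :
    HasDerivWithinAt (prim f) (w x) (Icc 0 1) x := by
  have : Fact (x ∈ Icc (0 : ℝ) 1) := ⟨hx⟩
  have h1 : HasDerivWithinAt (fun u => ∫ t in (0 : ℝ)..u, w t) (w x) (Icc 0 1) x := by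
    refine intervalIntegral.integral_hasDerivWithinAt_right ?_ ?_ (hw x hx)
    · exact (hw.mono (by rw [uIcc_of_le hx.1]; exact Icc_subset_Icc le_rfl hx.2)).intervalIntegrable
    · exact ⟨Icc 0 1, self_mem_nhdsWithin, hw.aestronglyMeasurable measurableSet_Icc⟩
  exact h1.congr (fun t ht => intervalIntegral_congr_L2 h ht) (intervalIntegral_congr_L2 h hx)

theorem prim_eq_of_hasDerivWithinAt {y w : ℝ → ℂ} (hw : ContinuousOn w (Icc 0 1))
    (hy : ∀ x ∈ Icc (0 : ℝ) 1, HasDerivWithinAt y (w x) (Icc 0 1) x) {f : L2} (h : f =ᵐ[mu01] w)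
    {x : ℝ} (hx : x ∈ Icc (0 : ℝ) 1) : prim f x = y x - y 0 := by
  rw [prim, intervalIntegral_congr_L2 h hx]
  refine intervalIntegral.integral_eq_sub_of_hasDerivAt_of_le hx.1 ?_ ?_ ?_
  · exact fun t ht => ((hy t ⟨ht.1, ht.2.trans hx.2⟩).continuousWithinAt).mono
      (Icc_subset_Icc le_rfl hx.2)
  · intro t ht
    exact (hy t ⟨ht.1.le, ht.2.le.trans hx.2⟩).hasDerivAt
      (Icc_mem_nhds ht.1 (ht.2.trans_le hx.2))
  · exact (hw.mono (by rw [uIcc_of_le hx.1]; exact Icc_subset_Icc le_rfl hx.2)).intervalIntegrable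

theorem smul_one_sub_volterra_coeFn (c : ℂ) (F : L2) :
    (c • one - volterra F : L2) =ᵐ[mu01] fun x => c - prim F x := by
  filter_upwards [Lp.coeFn_sub (c • one) (volterra F), Lp.coeFn_smul c one, one_coeFn,
    volterra_coeFn F] with x h1 h2 h3 h4
  rw [h1, Pi.sub_apply, h2, Pi.smul_apply, h3, h4, smul_eq_mul, mul_one]

theorem greenDeriv_coeFn (F : L2) :
    greenDeriv F =ᵐ[mu01] fun x => inner ℂ one (volterra F) - prim F x := by
  rw [greenDeriv_apply]
  exact smul_one_sub_volterra_coeFn _ F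

theorem green_coeFn (F : L2) : green F =ᵐ[mu01] prim (greenDeriv F) := volterra_coeFn _

theorem prim_greenDeriv_one (F : L2) : prim (greenDeriv F) 1 = 0 := by
  rw [prim_one_right, inner_one_greenDeriv]

/-! ### The potential, and the graph of `𝓛` as an operator equation -/

theorem ae_norm_le_of_memLp_top {q : ℝ → ℝ} (hq : MemLp q ∞ mu01) :
    ∀ᵐ x ∂mu01, |q x| ≤ (eLpNorm q ∞ mu01).toReal := by
  filter_upwards [ae_le_eLpNormEssSup (f := q) (μ := mu01)] with x hx
  rw [← eLpNorm_exponent_top] at hx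
  have := ENNReal.toReal_mono hq.2.ne hx
  simpa using this

theorem memLp_mul_L2 {q : ℝ → ℝ} (hq : MemLp q ∞ mu01) (f : L2) :
    MemLp (fun x => (q x : ℂ) * f x) 2 mu01 := by
  have h1 : AEStronglyMeasurable (fun x => (q x : ℂ)) mu01 :=
    Complex.continuous_ofReal.comp_aestronglyMeasurable hq.1
  refine (Lp.memLp f).of_le_mul (c := (eLpNorm q ∞ mu01).toReal) (h1.mul (Lp.memLp f).1) ?_
  filter_upwards [ae_norm_le_of_memLp_top hq] with x hx
  rw [norm_mul, Complex.norm_real, Real.norm_eq_abs]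
  gcongr

/-- Multiplication by a bounded potential. -/
noncomputable def potential {q : ℝ → ℝ} (hq : MemLp q ∞ mu01) : L2 →L[ℂ] L2 :=
  LinearMap.mkContinuous
    { toFun := fun f => (memLp_mul_L2 hq f).toLp (fun x => (q x : ℂ) * f x)
      map_add' := fun f g => by
        rw [← MemLp.toLp_add]
        apply MemLp.toLp_congr
        filter_upwards [Lp.coeFn_add f g] with x hx
        simp only [hx, Pi.add_apply, mul_add]
      map_smul' := fun c f => by
        rw [RingHom.id_apply, ← MemLp.toLp_const_smul]
        apply MemLp.toLp_congr
        filter_upwards [Lp.coeFn_smul c f] with x hx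
        simp only [hx, Pi.smul_apply, smul_eq_mul]
        ring } (eLpNorm q ∞ mu01).toReal (fun f => by
      refine Lp.norm_le_mul_norm_of_ae_le_mul ?_
      filter_upwards [ae_norm_le_of_memLp_top hq, (memLp_mul_L2 hq f).coeFn_toLp] with x hx h
      change ‖((memLp_mul_L2 hq f).toLp (fun x => (q x : ℂ) * f x) : L2) x‖ ≤ _
      rw [h, norm_mul, Complex.norm_real, Real.norm_eq_abs]
      gcongr)

theorem potential_coeFn {q : ℝ → ℝ} (hq : MemLp q ∞ mu01) (f : L2) :
    potential hq f =ᵐ[mu01] fun x => (q x : ℂ) * f x := (memLp_mul_L2 hq f).coeFn_toLp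

theorem inner_potential_comm {q : ℝ → ℝ} (hq : MemLp q ∞ mu01) (f g : L2) :
    inner ℂ (potential hq f) g = inner ℂ f (potential hq g) := by
  rw [L2.inner_def, L2.inner_def]
  apply integral_congr_ae
  filter_upwards [potential_coeFn hq f, potential_coeFn hq g] with x h1 h2
  simp only [h1, h2, RCLike.inner_apply, map_mul, Complex.conj_ofReal]
  ring

/-- The Dirichlet problem `-y'' = g - q f` has `green (g - q f)` as its only solution. This replaces
representatives and derivatives by bounded operators. -/
theorem mem_slGraph_iff {q : ℝ → ℝ} (hq : MemLp q ∞ mu01) (f g : L2) :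
    (f, g) ∈ slGraph q ↔ f = green (g - potential hq f) := by
  set F := g - potential hq f with hF
  constructor
  · rintro ⟨y, y', h, h0, h1, hd, hi, hf, hg⟩
    change (f : ℝ → ℂ) =ᵐ[mu01] y at hf
    change (g : ℝ → ℂ) =ᵐ[mu01] _ at hg
    have hFh : (F : ℝ → ℂ) =ᵐ[mu01] fun x => -h x := by
      filter_upwards [Lp.coeFn_sub g (potential hq f), potential_coeFn hq f, hf, hg]
        with x a b c d
      rw [hF, a, Pi.sub_apply, b, c, d]
      ring
    have hF' : ∀ x ∈ Icc (0 : ℝ) 1, y' x = y' 0 - prim F x := fun x hx => by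
      rw [hi x hx, prim, intervalIntegral_congr_L2 hFh hx, intervalIntegral.integral_neg,
        sub_neg_eq_add]
    have hc : ContinuousOn y' (Icc 0 1) :=
      (continuousOn_const.sub (continuousOn_prim F)).congr hF'
    have hw : (y' 0 • one - volterra F : L2) =ᵐ[mu01] y' := by
      filter_upwards [smul_one_sub_volterra_coeFn (y' 0) F, ae_mem_Ioo] with x a hx
      rw [a, hF' x (Ioo_subset_Icc_self hx)]
    have hy : ∀ x ∈ Icc (0 : ℝ) 1, prim (y' 0 • one - volterra F : L2) x = y x := fun x hx => by
      rw [prim_eq_of_hasDerivWithinAt hc hd hw hx, h0, sub_zero]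
    have hy1 := hy 1 (by simp)
    -- The condition `y 1 = 0` fixes the free slope `y' 0` to be the constant occurring in
    -- `greenDeriv`.
    rw [h1, prim_one_right, inner_sub_right, inner_smul_right, inner_one_one, mul_one,
      sub_eq_zero] at hy1
    rw [hy1, ← greenDeriv_apply] at hy
    apply Lp.ext
    filter_upwards [hf, green_coeFn F, ae_mem_Ioo] with x a b hx
    rw [b, a, hy x (Ioo_subset_Icc_self hx)]
  · intro h
    have hcont : ContinuousOn (fun x => inner ℂ one (volterra F) - prim F x) (Icc (0 : ℝ) 1) :=
      continuousOn_const.sub (continuousOn_prim F)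
    refine ⟨prim (greenDeriv F), fun x => inner ℂ one (volterra F) - prim F x, -F,
      prim_zero_right _, prim_greenDeriv_one F,
      fun x hx => hasDerivWithinAt_prim hcont (greenDeriv_coeFn F) hx, fun x hx => ?_, ?_, ?_⟩
    · rw [intervalIntegral_congr_L2 (Lp.coeFn_neg F) hx]
      simp only [Pi.neg_apply, intervalIntegral.integral_neg, prim]
      simp [sub_eq_add_neg]
    · change (f : ℝ → ℂ) =ᵐ[mu01] _
      rw [h]
      exact green_coeFn F
    · change (g : ℝ → ℂ) =ᵐ[mu01] _
      have hf : (f : ℝ → ℂ) =ᵐ[mu01] prim (greenDeriv F) := by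
        have := green_coeFn F
        rwa [← h] at this
      filter_upwards [hf, Lp.coeFn_neg F, Lp.coeFn_sub g (potential hq f), potential_coeFn hq f]
        with x a b c d
      rw [b, Pi.neg_apply, hF, c, Pi.sub_apply, d, a]
      ring

/-! ### Symmetry of `𝓛` and the energy estimate -/

section Graph

variable {q : ℝ → ℝ}

theorem mem_slGraph_iff_exists {p : L2 × L2} :
    p ∈ slGraph q ↔ ∃ h : p.1 ∈ (slOperator q).domain, slOperator q ⟨p.1, h⟩ = p.2 := by
  rw [← slOperator_graph, LinearPMap.mem_graph_iff]
  constructor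
  · rintro ⟨⟨y, hy⟩, rfl, h⟩
    exact ⟨hy, h⟩
  · rintro ⟨h, h'⟩
    exact ⟨⟨p.1, h⟩, rfl, h'⟩

theorem slApply_eq {f g : L2} (h : (f, g) ∈ slGraph q) : slApply q f = g := by
  obtain ⟨h1, h2⟩ := mem_slGraph_iff_exists.1 h
  rw [slApply, dif_pos h1]
  exact h2

theorem slApply_mem_slGraph {f : L2} (h : f ∈ (slOperator q).domain) :
    (f, slApply q f) ∈ slGraph q :=
  mem_slGraph_iff_exists.2 ⟨h, by rw [slApply, dif_pos h]⟩

theorem mem_domain {f g : L2} (h : (f, g) ∈ slGraph q) : f ∈ (slOperator q).domain :=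
  (mem_slGraph_iff_exists.1 h).1

theorem isEigenpair_iff {l : ℝ} {e : L2} :
    IsEigenpair q l e ↔ e ≠ 0 ∧ (e, (l : ℂ) • e) ∈ slGraph q := by
  rw [IsEigenpair, mem_slGraph_iff_exists]

theorem slApply_iterate_eigen {l : ℝ} {e : L2} (h : (e, (l : ℂ) • e) ∈ slGraph q) (j : ℕ) :
    (slApply q)^[j] e = (l : ℂ) ^ j • e := by
  induction j with
  | zero => simp
  | succ j ih =>
    rw [Function.iterate_succ_apply', ih, slApply_smul q _ (mem_domain h), slApply_eq h, smul_smul,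
      pow_succ]

theorem mem_testSpace_of_eigen {l : ℝ} {e : L2} (h : (e, (l : ℂ) • e) ∈ slGraph q) :
    e ∈ testSpace q := fun j => by
  rw [slApply_iterate_eigen h]
  exact Submodule.smul_mem _ _ (mem_domain h)

/-- Symmetry is inherited from `green`: the potential terms on the two sides cancel because `q` is
real. -/
theorem inner_slGraph_comm (hq : MemLp q ∞ mu01) {p r : L2 × L2} (hp : p ∈ slGraph q) (hr : r ∈ slGraph q) :
    inner ℂ p.2 r.1 = inner ℂ p.1 r.2 := by
  obtain ⟨f, g⟩ := p
  obtain ⟨f', g'⟩ := r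
  rw [mem_slGraph_iff hq] at hp hr
  have h := inner_green_comm (g - potential hq f) (g' - potential hq f')
  rw [← hp, ← hr, inner_sub_left, inner_sub_right, inner_potential_comm] at h
  change inner ℂ g f' = inner ℂ f g'
  linear_combination -h

/-- This is the energy identity `‖y'‖² = ⟨f, g⟩ - ⟨f, q f⟩`, obtained from `inner_green` with equal
arguments, with the potential term estimated crudely. -/
theorem norm_greenDeriv_sq_le (hq : MemLp q ∞ mu01) {f g : L2} (h : (f, g) ∈ slGraph q) :
    ‖greenDeriv (g - potential hq f)‖ ^ 2 ≤ (inner ℂ f g).re + ‖potential hq‖ * ‖f‖ ^ 2 := by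
  have h0 := h
  rw [mem_slGraph_iff hq] at h
  have h1 := inner_green (g - potential hq f) (g - potential hq f)
  rw [← h, inner_self_eq_norm_sq_to_K, inner_sub_right] at h1
  have h2 := congrArg Complex.re h1
  rw [Complex.sub_re] at h2
  have h3 : ((‖greenDeriv (g - potential hq f)‖ : ℂ) ^ 2).re =
    ‖greenDeriv (g - potential hq f)‖ ^ 2 := by
    rw [← Complex.ofReal_pow, Complex.ofReal_re]
  have h4 : ‖inner ℂ f (potential hq f)‖ ≤ ‖potential hq‖ * ‖f‖ ^ 2 := by
    refine (norm_inner_le_norm _ _).trans ?_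
    have := (potential hq).le_opNorm f
    nlinarith [norm_nonneg f]
  have h5 := (abs_le.1 ((Complex.abs_re_le_norm _).trans h4)).1
  have h6 : ((‖greenDeriv (g - potential hq f)‖ : ℂ) ^ 2).re = _ := h2.symm
  rw [h3] at h6
  linarith

end Graph

/-! ### Uniqueness for the initial value problem and simplicity of eigenvalues -/

/-- Grönwall: the integral `S` of `a` satisfies `|S'| ≤ K |S|` and `S 0 = 0`. -/
theorem eq_zero_of_le_mul_integral {a : ℝ → ℝ} (ha : ContinuousOn a (Icc 0 1)) {K : ℝ}
    (h0 : ∀ x ∈ Icc (0 : ℝ) 1, 0 ≤ a x)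
    (h : ∀ x ∈ Icc (0 : ℝ) 1, a x ≤ K * ∫ t in (0 : ℝ)..x, a t) :
    ∀ x ∈ Icc (0 : ℝ) 1, a x = 0 := by
  have hS : ∀ x ∈ Icc (0 : ℝ) 1, HasDerivWithinAt (fun u => ∫ t in (0 : ℝ)..u, a t) (a x)
      (Icc 0 1) x := fun x hx => by
    have : Fact (x ∈ Icc (0 : ℝ) 1) := ⟨hx⟩
    refine intervalIntegral.integral_hasDerivWithinAt_right ?_ ?_ (ha x hx)
    · exact (ha.mono (by rw [uIcc_of_le hx.1]; exact Icc_subset_Icc le_rfl hx.2)).intervalIntegrable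
    · exact ⟨Icc 0 1, self_mem_nhdsWithin, ha.aestronglyMeasurable measurableSet_Icc⟩
  have hSnn : ∀ x ∈ Icc (0 : ℝ) 1, 0 ≤ ∫ t in (0 : ℝ)..x, a t := fun x hx =>
    intervalIntegral.integral_nonneg hx.1 fun t ht => h0 t ⟨ht.1, ht.2.trans hx.2⟩
  have hz := eq_zero_of_abs_deriv_le_mul_abs_self_of_eq_zero_right
    (f := fun u => ∫ t in (0 : ℝ)..u, a t) (f' := a) (K := K) (a := 0) (b := 1)
    (fun x hx => (hS x hx).continuousWithinAt)
    (fun x hx => (hS x (Ico_subset_Icc_self hx)).mono_of_mem_nhdsWithin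
      (mem_of_superset (Icc_mem_nhdsGE hx.2) (Icc_subset_Icc_left hx.1)))
    (by simp) (fun x hx => by
      have hx' := Ico_subset_Icc_self hx
      rw [Real.norm_of_nonneg (h0 x hx'), Real.norm_of_nonneg (hSnn x hx')]
      exact h x hx')
  intro x hx
  have := h x hx
  rw [hz x hx, mul_zero] at this
  exact le_antisymm this (h0 x hx)

theorem ae_imp_of_ae_mu01 {p : ℝ → Prop} (h : ∀ᵐ x ∂mu01, p x) {x : ℝ} (hx : x ≤ 1) :
    ∀ᵐ t, t ∈ Ioc 0 x → p t := by
  rw [ae_restrict_iff' measurableSet_Ioo] at h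
  filter_upwards [h, Measure.ae_ne volume (1 : ℝ)] with t ht h1 htx
  exact ht ⟨htx.1, lt_of_le_of_ne (htx.2.trans hx) h1⟩

theorem norm_prim_le_integral {f : L2} {b : ℝ → ℝ} (hb : ContinuousOn b (Icc 0 1))
    (h : ∀ᵐ x ∂mu01, ‖f x‖ ≤ b x) {x : ℝ} (hx : x ∈ Icc (0 : ℝ) 1) :
    ‖prim f x‖ ≤ ∫ t in (0 : ℝ)..x, b t :=
  intervalIntegral.norm_integral_le_of_norm_le hx.1 (ae_imp_of_ae_mu01 h hx.2)
    (hb.mono (by rw [uIcc_of_le hx.1]; exact Icc_subset_Icc le_rfl hx.2)).intervalIntegrable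

/-- Uniqueness for the initial value problem `y'' = -F`, `y(0) = y'(0) = 0`, `|F| ≤ K |y|`. -/
theorem eq_zero_of_volterra_volterra {f F : L2} (hf : f = -volterra (volterra F)) {K : ℝ}
    (hK : 0 ≤ K) (hF : ∀ᵐ x ∂mu01, ‖F x‖ ≤ K * ‖f x‖) : f = 0 := by
  set y := prim (volterra F) with hy
  have hfy : ∀ᵐ x ∂mu01, f x = -y x := by
    filter_upwards [Lp.coeFn_neg (volterra (volterra F)), volterra_coeFn (volterra F)] with x a b
    rw [hf, a, Pi.neg_apply, b]
  have cy : ContinuousOn y (Icc 0 1) := continuousOn_prim _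
  have cF : ContinuousOn (prim F) (Icc 0 1) := continuousOn_prim _
  have hint : ∀ {b : ℝ → ℝ}, ContinuousOn b (Icc 0 1) → ∀ x ∈ Icc (0 : ℝ) 1,
      IntervalIntegrable b volume 0 x := fun hb x hx =>
    (hb.mono (by rw [uIcc_of_le hx.1]; exact Icc_subset_Icc le_rfl hx.2)).intervalIntegrable
  -- Grönwall is applied to the first order system for `y` and `y' = prim F`: `y` is controlled by
  -- the integral of `|y'|`, and `y'` by `K` times that of `|y|`. Hence the constant `1 + K`.
  have key := eq_zero_of_le_mul_integral (a := fun x => ‖y x‖ + ‖prim F x‖) (K := 1 + K)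
    (cy.norm.add cF.norm) (fun x _ => by positivity) (fun x hx => by
      have h1 : ‖y x‖ ≤ ∫ t in (0 : ℝ)..x, ‖prim F t‖ :=
        norm_prim_le_integral cF.norm (by
          filter_upwards [volterra_coeFn F] with t ht
          rw [ht]) hx
      have h2 : ‖prim F x‖ ≤ ∫ t in (0 : ℝ)..x, K * ‖y t‖ :=
        norm_prim_le_integral (continuousOn_const.mul cy.norm) (by
          filter_upwards [hF, hfy] with t ht h
          rw [h, norm_neg] at ht
          exact ht) hx
      rw [intervalIntegral.integral_const_mul] at h2
      rw [intervalIntegral.integral_add (hint cy.norm x hx) (hint cF.norm x hx)]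
      have h3 : 0 ≤ ∫ t in (0 : ℝ)..x, ‖prim F t‖ :=
        intervalIntegral.integral_nonneg hx.1 fun t _ => norm_nonneg _
      have h4 : 0 ≤ ∫ t in (0 : ℝ)..x, ‖y t‖ :=
        intervalIntegral.integral_nonneg hx.1 fun t _ => norm_nonneg _
      nlinarith)
  apply (Lp.eq_zero_iff_ae_eq_zero).2
  filter_upwards [hfy, ae_mem_Ioo] with x h hx
  have h1 := key x (Ioo_subset_Icc_self hx)
  have h2 : ‖y x‖ = 0 := by linarith [norm_nonneg (y x), norm_nonneg (prim F x)]
  rw [h, norm_eq_zero.1 h2, neg_zero]; rfl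

theorem ae_norm_le_of_eigen {q : ℝ → ℝ} (hq : MemLp q ∞ mu01) (l : ℝ) (e : L2) :
    ∀ᵐ x ∂mu01, ‖((l : ℂ) • e - potential hq e : L2) x‖ ≤
      (|l| + (eLpNorm q ∞ mu01).toReal) * ‖e x‖ := by
  filter_upwards [Lp.coeFn_sub ((l : ℂ) • e) (potential hq e), Lp.coeFn_smul (l : ℂ) e,
    potential_coeFn hq e, ae_norm_le_of_memLp_top hq] with x a b c d
  rw [a, Pi.sub_apply, b, c, Pi.smul_apply, smul_eq_mul]
  refine (norm_sub_le _ _).trans ?_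
  rw [norm_mul, norm_mul, Complex.norm_real, Complex.norm_real, add_mul, Real.norm_eq_abs,
    Real.norm_eq_abs]
  gcongr

/-- The derivative at `0` of an eigenfunction with eigenvalue `l`. -/
noncomputable def initialSlope {q : ℝ → ℝ} (hq : MemLp q ∞ mu01) (l : ℝ) : L2 →L[ℂ] ℂ :=
  ((innerSL ℂ one).comp volterra).comp ((l : ℂ) • ContinuousLinearMap.id ℂ L2 - potential hq)

theorem initialSlope_apply {q : ℝ → ℝ} (hq : MemLp q ∞ mu01) (l : ℝ) (e : L2) :
    initialSlope hq l e = inner ℂ one (volterra ((l : ℂ) • e - potential hq e)) := by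
  simp only [initialSlope, ContinuousLinearMap.comp_apply, sub_apply, smul_apply,
    ContinuousLinearMap.id_apply, innerSL_apply_apply]

/-- An eigenfunction vanishes at `0`; if its slope vanishes there too, it solves the initial value
problem with zero data. Hence `initialSlope` is injective on each eigenspace, which is therefore at
most one-dimensional. -/
theorem eq_zero_of_initialSlope {q : ℝ → ℝ} (hq : MemLp q ∞ mu01) {l : ℝ} {e : L2}
    (h : (e, (l : ℂ) • e) ∈ slGraph q) (h0 : initialSlope hq l e = 0) : e = 0 := by
  rw [mem_slGraph_iff hq] at h
  rw [initialSlope_apply] at h0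
  refine eq_zero_of_volterra_volterra (F := (l : ℂ) • e - potential hq e) ?_ (by positivity)
    (ae_norm_le_of_eigen hq l e)
  conv_lhs => rw [h]
  rw [green_apply, greenDeriv_apply, h0, zero_smul, zero_sub, map_neg]

/-- The eigenvalues are simple. -/
theorem exists_smul_eq_of_eigen {q : ℝ → ℝ} (hq : MemLp q ∞ mu01) {l : ℝ} {e f : L2}
    (he : IsEigenpair q l e) (hf : (f, (l : ℂ) • f) ∈ slGraph q) : ∃ c : ℂ, f = c • e := by
  obtain ⟨h0, he⟩ := isEigenpair_iff.1 he
  have hs : initialSlope hq l e ≠ 0 := fun h => h0 (eq_zero_of_initialSlope hq he h)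
  refine ⟨initialSlope hq l f / initialSlope hq l e, ?_⟩
  rw [← sub_eq_zero]
  refine eq_zero_of_initialSlope hq (l := l) ?_ ?_
  · have := Submodule.sub_mem _ hf (Submodule.smul_mem _
      (initialSlope hq l f / initialSlope hq l e) he)
    rwa [Prod.smul_mk, Prod.mk_sub_mk, smul_comm, ← smul_sub] at this
  · rw [map_sub, map_smul, smul_eq_mul, div_mul_cancel₀ _ hs, sub_self]

/-! ### Complex conjugation and real eigenfunctions -/

section Star

theorem prim_star (f : L2) {x : ℝ} (hx : x ∈ Icc (0 : ℝ) 1) : prim (star f) x = star (prim f x) := by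
  have h : prim (star f) x = ∫ t in (0 : ℝ)..x, (starRingEnd ℂ) (f t) :=
    intervalIntegral_congr_L2 (Lp.coeFn_star f) hx
  rw [h, prim, intervalIntegral.integral_of_le hx.1, intervalIntegral.integral_of_le hx.1,
    integral_conj]
  rfl

theorem volterra_star (f : L2) : volterra (star f) = star (volterra f) := by
  apply Lp.ext
  filter_upwards [volterra_coeFn (star f), volterra_coeFn f, Lp.coeFn_star (volterra f),
    ae_mem_Ioo] with x a b c hx
  rw [a, c, Pi.star_apply, b, prim_star f (Ioo_subset_Icc_self hx)]

theorem one_star : star one = one := by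
  apply Lp.ext
  filter_upwards [Lp.coeFn_star one, one_coeFn] with x a b
  rw [a, Pi.star_apply, b, star_one]

theorem L2_star_smul (c : ℂ) (f : L2) : star (c • f) = star c • star f := by
  apply Lp.ext
  filter_upwards [Lp.coeFn_star (c • f), Lp.coeFn_star f, Lp.coeFn_smul c f,
    Lp.coeFn_smul (star c) (star f)] with x a b d e
  rw [a, e, Pi.star_apply, d, Pi.smul_apply, Pi.smul_apply, b, Pi.star_apply, star_smul]

theorem L2_star_sub (f g : L2) : star (f - g) = star f - star g := by
  apply Lp.ext
  filter_upwards [Lp.coeFn_star (f - g), Lp.coeFn_star f, Lp.coeFn_star g, Lp.coeFn_sub f g,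
    Lp.coeFn_sub (star f) (star g)] with x a b c d e
  rw [a, e, Pi.star_apply, d, Pi.sub_apply, Pi.sub_apply, b, c, Pi.star_apply, Pi.star_apply,
    star_sub]

theorem inner_one_star (f : L2) : inner ℂ one (star f) = star (inner ℂ one f : ℂ) := by
  rw [← prim_one_right, ← prim_one_right, prim_star _ (by simp)]

theorem greenDeriv_star (F : L2) : greenDeriv (star F) = star (greenDeriv F) := by
  rw [greenDeriv_apply, greenDeriv_apply, L2_star_sub, L2_star_smul, one_star, volterra_star,
    inner_one_star]

theorem green_star (F : L2) : green (star F) = star (green F) := by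
  rw [green_apply, green_apply, greenDeriv_star, volterra_star]

theorem potential_star {q : ℝ → ℝ} (hq : MemLp q ∞ mu01) (f : L2) :
    potential hq (star f) = star (potential hq f) := by
  apply Lp.ext
  filter_upwards [potential_coeFn hq f, potential_coeFn hq (star f), Lp.coeFn_star f,
    Lp.coeFn_star (potential hq f)] with x a b c d
  rw [b, d, c, Pi.star_apply, Pi.star_apply, a, star_mul']
  simp

theorem star_mem_slGraph {q : ℝ → ℝ} (hq : MemLp q ∞ mu01) {f g : L2} (h : (f, g) ∈ slGraph q) :
    (star f, star g) ∈ slGraph q := by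
  rw [mem_slGraph_iff hq] at h ⊢
  rw [potential_star, ← L2_star_sub, green_star, ← h]

end Star

/-- Every eigenvalue has a real-valued normalised eigenfunction. -/
theorem IsEigenvalue.exists_real_normalized {q : ℝ → ℝ} (hq : MemLp q ∞ mu01) {l : ℝ}
    (h : IsEigenvalue q l) :
    ∃ e : L2, IsEigenpair q l e ∧ ‖e‖ = 1 ∧ ∀ᵐ x ∂mu01, (e x).im = 0 := by
  obtain ⟨e, he⟩ := h
  obtain ⟨h0, he⟩ := isEigenpair_iff.1 he
  have hs : (star e, (l : ℂ) • star e) ∈ slGraph q := by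
    have := star_mem_slGraph hq he
    rwa [L2_star_smul, Complex.star_def, Complex.conj_ofReal] at this
  obtain ⟨f, hf0, hf, hfs⟩ : ∃ f : L2, f ≠ 0 ∧ (f, (l : ℂ) • f) ∈ slGraph q ∧
      ∀ᵐ x ∂mu01, (f x).im = 0 := by
    -- Twice the real part of `e` serves unless it is zero; in that case `e` is purely imaginary and
    -- `I • e` is real.
    by_cases hz : e + star e = 0
    · refine ⟨Complex.I • e, smul_ne_zero Complex.I_ne_zero h0, ?_, ?_⟩
      · have := Submodule.smul_mem _ Complex.I he
        rwa [Prod.smul_mk, smul_comm] at this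
      · have h1 := Lp.coeFn_add e (star e)
        rw [hz] at h1
        filter_upwards [h1, Lp.coeFn_star e, Lp.coeFn_zero ℂ 2 mu01, Lp.coeFn_smul Complex.I e]
          with x a b c d
        rw [c, Pi.add_apply, b, Pi.star_apply] at a
        rw [d]
        have := congrArg Complex.re a
        have h2 : (e x).re = 0 := by
          simp only [Pi.zero_apply, Complex.zero_re, Complex.add_re, Complex.star_def,
            Complex.conj_re] at this
          linarith
        simp [h2]
    · refine ⟨e + star e, hz, ?_, ?_⟩
      · have := Submodule.add_mem _ he hs
        rwa [Prod.mk_add_mk, ← smul_add] at this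
      · filter_upwards [Lp.coeFn_add e (star e), Lp.coeFn_star e] with x a b
        rw [a, Pi.add_apply, b, Pi.star_apply]
        simp
  have hn : ‖f‖ ≠ 0 := norm_ne_zero_iff.2 hf0
  refine ⟨((‖f‖⁻¹ : ℝ) : ℂ) • f, isEigenpair_iff.2 ⟨smul_ne_zero ?_ hf0, ?_⟩, ?_, ?_⟩
  · exact_mod_cast inv_ne_zero hn
  · have := Submodule.smul_mem _ ((‖f‖⁻¹ : ℝ) : ℂ) hf
    rwa [Prod.smul_mk, smul_comm] at this
  · rw [norm_smul, Complex.norm_real, norm_inv, norm_norm, inv_mul_cancel₀ hn]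
  · filter_upwards [hfs, Lp.coeFn_smul ((‖f‖⁻¹ : ℝ) : ℂ) f] with x a b
    rw [b, Pi.smul_apply, smul_eq_mul, Complex.im_ofReal_mul, a, mul_zero]

/-- On a nontrivial finite-dimensional complex space `volterra` would have an eigenvector. It has
none: a nonzero eigenvalue is excluded by Grönwall, and the eigenvalue `0` because a vanishing
primitive forces a vanishing function. The result yields infinitely many eigenvalues of `𝓛`. -/
theorem not_finiteDimensional_L2 : ¬ FiniteDimensional ℂ L2 := by
  intro h
  have : Nontrivial L2 := ⟨one, 0, by rw [← norm_ne_zero_iff, norm_one_L2]; exact one_ne_zero⟩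
  obtain ⟨μ, hμ⟩ := Module.End.exists_eigenvalue (volterra : Module.End ℂ L2)
  obtain ⟨f, hf⟩ := hμ.exists_hasEigenvector
  have hV : volterra f = μ • f := hf.apply_eq_smul
  refine hf.2 ?_
  by_cases h0 : μ = 0
  · have hz : volterra f = 0 := by rw [hV, h0, zero_smul]
    have hD : greenDeriv f = 0 := by simp [greenDeriv_apply, hz]
    -- If `volterra f = 0` then `green f = 0`, so `(0, f)` is in the graph for the zero potential,
    -- which is single-valued.
    exact slGraph_functional 0 (0, f)
      ((mem_slGraph_iff MemLp.zero 0 f).2 (by simp [green_apply, hD])) rfl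
  · have hp : ∀ᵐ x ∂mu01, f x = μ⁻¹ * prim f x := by
      filter_upwards [volterra_coeFn f, Lp.coeFn_smul μ f] with x a b
      rw [← a, hV, b, Pi.smul_apply, smul_eq_mul, inv_mul_cancel_left₀ h0]
    have cF : ContinuousOn (prim f) (Icc 0 1) := continuousOn_prim _
    have key := eq_zero_of_le_mul_integral (a := fun x => ‖prim f x‖) (K := ‖μ⁻¹‖) cF.norm
      (fun x _ => norm_nonneg _) (fun x hx => by
        rw [← intervalIntegral.integral_const_mul]
        refine norm_prim_le_integral (continuousOn_const.mul cF.norm) ?_ hx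
        filter_upwards [hp] with t ht
        rw [ht, norm_mul]
        rfl)
    apply (Lp.eq_zero_iff_ae_eq_zero).2
    filter_upwards [hp, ae_mem_Ioo] with x a hx
    rw [a, norm_eq_zero.1 (key x (Ioo_subset_Icc_self hx)), mul_zero]; rfl

/-! ### The compact inverse of `𝓛` -/

section Resolvent

/-- Positivity enters here by excluding the eigenvalue `0`. -/
theorem eq_zero_of_mem_slGraph_zero {q : ℝ → ℝ} (hpos : ∀ l : ℝ, IsEigenvalue q l → 0 < l) {f : L2} (h : (f, 0) ∈ slGraph q) : f = 0 := by
  by_contra hf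
  exact lt_irrefl _ (hpos 0 ⟨f, isEigenpair_iff.2 ⟨hf, by simpa using h⟩⟩)

/-- `𝓛` has a compact inverse. -/
theorem exists_compact_inverse {q : ℝ → ℝ} (hq : MemLp q ∞ mu01)
    (hpos : ∀ l : ℝ, IsEigenvalue q l → 0 < l) : ∃ R : L2 →L[ℂ] L2, IsCompactOperator R ∧
    ∀ f g : L2, (f, g) ∈ slGraph q ↔ f = R g := by
  have hT : IsCompactOperator (green.comp (potential hq)) :=
    isCompactOperator_green.comp_clm (potential hq)
  -- The graph equation reads `(1 + green ∘ q) f = green g`. By the Fredholm alternative for the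
  -- compact operator `green ∘ q`, the left side is invertible unless `-1` is an eigenvalue, and an
  -- eigenvector for `-1` would lie in the kernel of `𝓛`.
  have hres : (-1 : ℂ) ∈ resolventSet ℂ (green.comp (potential hq)) := by
    refine (hT.hasEigenvalue_or_mem_resolventSet (μ := -1) (by norm_num)).resolve_left ?_
    intro h
    obtain ⟨f, hf⟩ := h.exists_hasEigenvector
    have h1 : green (potential hq f) = (-1 : ℂ) • f := hf.apply_eq_smul
    refine hf.2 (eq_zero_of_mem_slGraph_zero hpos ((mem_slGraph_iff hq f 0).2 ?_))
    rw [zero_sub, map_neg, h1, neg_smul, one_smul, neg_neg]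
  rw [spectrum.mem_resolventSet_iff] at hres
  obtain ⟨U, hU⟩ := hres
  have hUf : ∀ f, (U : L2 →L[ℂ] L2) f = -f - green (potential hq f) := fun f => by
    rw [hU, Algebra.algebraMap_eq_smul_one]
    simp
  have hinv : ∀ f, (↑U⁻¹ : L2 →L[ℂ] L2) ((U : L2 →L[ℂ] L2) f) = f := fun f => by
    rw [← mul_apply_eq_comp, Units.inv_mul]; rfl
  have hinv' : ∀ f, (U : L2 →L[ℂ] L2) ((↑U⁻¹ : L2 →L[ℂ] L2) f) = f := fun f => by
    rw [← mul_apply_eq_comp, Units.mul_inv]; rfl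
  refine ⟨-((↑U⁻¹ : L2 →L[ℂ] L2).comp green), (isCompactOperator_green.clm_comp _).neg,
    fun f g => ?_⟩
  rw [mem_slGraph_iff hq, map_sub]
  have h2 : (-((↑U⁻¹ : L2 →L[ℂ] L2).comp green)) g = (↑U⁻¹ : L2 →L[ℂ] L2) (-green g) := by
    rw [map_neg]; rfl
  rw [h2]
  constructor
  · intro h
    rw [← hinv f, hUf]
    congr 1
    linear_combination (norm := module) -h
  · intro h
    have := congrArg (U : L2 →L[ℂ] L2) h
    rw [hinv', hUf] at this
    linear_combination (norm := module) -this

end Resolvent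

theorem inner_eigen_eq_zero {q : ℝ → ℝ} (hq : MemLp q ∞ mu01) {l m : ℝ} (hlm : l ≠ m) {e f : L2}
    (he : IsEigenpair q l e) (hf : IsEigenpair q m f) : inner ℂ e f = 0 := by
  have h := inner_slGraph_comm hq (isEigenpair_iff.1 he).2 (isEigenpair_iff.1 hf).2
  simp only [inner_smul_left, inner_smul_right, Complex.conj_ofReal] at h
  have h2 : ((l : ℂ) - m) * inner ℂ e f = 0 := by linear_combination h
  refine (mul_eq_zero.1 h2).resolve_left ?_
  exact sub_ne_zero.2 (by exact_mod_cast hlm)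

/-! ### Completeness and enumeration of the spectrum -/

section Spectral

variable {q : ℝ → ℝ} (hq : MemLp q ∞ mu01) (hpos : ∀ l : ℝ, IsEigenvalue q l → 0 < l)
include hq hpos

/-- The eigenfunctions are complete in `L²(0,1)`. -/
theorem eq_zero_of_inner_eigen {f : L2} (h : ∀ l e, IsEigenpair q l e → inner ℂ e f = 0) :
    f = 0 := by
  obtain ⟨R, hc, hR⟩ := exists_compact_inverse hq hpos
  have hsymm : (R : L2 →ₗ[ℂ] L2).IsSymmetric := fun g g' =>
    (inner_slGraph_comm hq ((hR (R g) g).2 rfl) ((hR (R g') g').2 rfl)).symm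
  have hbot := ContinuousLinearMap.orthogonalComplement_iSup_eigenspaces_eq_bot hc hsymm
  have hf : f ∈ (⨆ μ, Module.End.eigenspace (R : Module.End ℂ L2) μ)ᗮ := by
    rw [← Submodule.iInf_orthogonal, Submodule.mem_iInf]
    intro μ e he
    by_cases he0 : e = 0
    · rw [he0, inner_zero_left]
    have hRe : R e = μ • e := Module.End.mem_eigenspace_iff.1 he
    have hμr := hsymm.conj_eigenvalue_eq_self
      (Module.End.hasEigenvalue_of_hasEigenvector ⟨he, he0⟩)
    -- The inverse has no kernel, since `R e = 0` would put `(0, e)` in the graph. So each of its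
    -- eigenvectors is an eigenvector of `𝓛`, with the real eigenvalue `μ⁻¹`.
    have hμ0 : μ ≠ 0 := by
      rintro rfl
      refine he0 (slGraph_functional q (0, e) ((hR 0 e).2 ?_) rfl)
      rw [hRe, zero_smul]
    have hg : (e, μ⁻¹ • e) ∈ slGraph q := (hR _ _).2 (by
      rw [map_smul, hRe, smul_smul, inv_mul_cancel₀ hμ0, one_smul])
    have hre : ((μ⁻¹.re : ℝ) : ℂ) = μ⁻¹ :=
      Complex.conj_eq_iff_re.1 (by rw [map_inv₀, hμr])
    exact h μ⁻¹.re e (isEigenpair_iff.2 ⟨he0, by rwa [hre]⟩)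
  rw [hbot] at hf
  exact (Submodule.mem_bot ℂ).1 hf

/-- Otherwise there is an infinite orthonormal family of eigenfunctions with eigenvalues at most
`Λ`. Their images under the inverse are pairwise at distance at least `Λ⁻¹`, as seen by pairing a
difference with one of the two eigenfunctions, and no subsequence converges, against compactness. -/
theorem finite_eigenvalues_le (Λ : ℝ) : {l | IsEigenvalue q l ∧ l ≤ Λ}.Finite := by
  by_contra hinf
  obtain ⟨R, hc, hR⟩ := exists_compact_inverse hq hpos
  set l := Set.Infinite.natEmbedding _ hinf
  choose e he hn _ using fun n => (l n).2.1.exists_real_normalized hq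
  have hl : ∀ n, 0 < (l n : ℝ) := fun n => hpos _ (l n).2.1
  have hΛ : 0 < Λ := (hl 0).trans_le (l 0).2.2
  have hRe : ∀ n, R (e n) = (((l n : ℝ)⁻¹ : ℝ) : ℂ) • e n := fun n => by
    have h := (hR _ _).1 (isEigenpair_iff.1 (he n)).2
    conv_rhs => rw [h, map_smul, smul_smul, ← Complex.ofReal_mul, inv_mul_cancel₀ (hl n).ne',
      Complex.ofReal_one, one_smul]
  obtain ⟨K, hK, hK'⟩ := hc.image_closedBall_subset_compact 1
  obtain ⟨y, -, ψ, hψ, hψy⟩ := hK.tendsto_subseq (x := fun n => R (e n)) fun n =>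
    hK' ⟨e n, by simp [hn], rfl⟩
  have hcs := hψy.cauchySeq
  rw [Metric.cauchySeq_iff'] at hcs
  obtain ⟨N, hN⟩ := hcs Λ⁻¹ (by positivity)
  have h1 := hN (N + 1) (by omega)
  have hne : (l (ψ (N + 1)) : ℝ) ≠ l (ψ N) := fun h => by
    have := hψ.injective (l.injective (Subtype.ext h))
    omega
  have h2 : ‖inner ℂ (e (ψ (N + 1))) (R (e (ψ (N + 1))) - R (e (ψ N)))‖ =
      (l (ψ (N + 1)) : ℝ)⁻¹ := by
    rw [hRe, hRe, inner_sub_right, inner_smul_right, inner_smul_right,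
      inner_eigen_eq_zero hq hne (he _) (he _), inner_self_eq_norm_sq_to_K, hn]
    simp [abs_of_pos (hl (ψ (N + 1)))]
  have h3 := norm_inner_le_norm (𝕜 := ℂ) (e (ψ (N + 1))) (R (e (ψ (N + 1))) - R (e (ψ N)))
  rw [h2, hn, one_mul, ← dist_eq_norm] at h3
  have h4 : Λ⁻¹ ≤ (l (ψ (N + 1)) : ℝ)⁻¹ := inv_anti₀ (hl _) (l (ψ (N + 1))).2.2
  simp only [Function.comp_apply] at h1
  linarith

/-- With finitely many simple eigenvalues, completeness would embed `L²(0,1)` by its coefficients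
into a finite-dimensional space. -/
theorem infinite_eigenvalues : {l | IsEigenvalue q l}.Infinite := by
  intro hfin
  have : Finite {l | IsEigenvalue q l} := hfin
  choose e he _ _ using fun l : {l | IsEigenvalue q l} => l.2.exists_real_normalized hq
  refine not_finiteDimensional_L2 (FiniteDimensional.of_injective
    (LinearMap.pi fun l => (innerSL ℂ (e l) : L2 →ₗ[ℂ] ℂ)) ?_)
  rw [← LinearMap.ker_eq_bot, LinearMap.ker_eq_bot']
  intro f hf
  refine eq_zero_of_inner_eigen hq hpos fun l e' he' => ?_
  obtain ⟨c, hc⟩ := exists_smul_eq_of_eigen hq (he ⟨l, e', he'⟩) (isEigenpair_iff.1 he').2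
  have := congrFun hf ⟨l, e', he'⟩
  simp only [LinearMap.pi_apply, ContinuousLinearMap.coe_coe, innerSL_apply_apply,
    Pi.zero_apply] at this
  rw [hc, inner_smul_left, this, mul_zero]

/-- The set of eigenvalues is an infinite linear order whose initial segments are finite. It
therefore has a least element, no greatest one, and is order isomorphic to `ℕ`. -/
theorem exists_eigensystem : ∃ (lam : ℕ → ℝ) (φ : ℕ → testSpace q), IsEigensystem q lam φ := by
  have hfin := finite_eigenvalues_le hq hpos
  have hinf := infinite_eigenvalues hq hpos
  let ι := {l : ℝ // IsEigenvalue q l}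
  have hfinι : ∀ a : ι, (Iic a).Finite := fun a => by
    refine Finite.of_finite_image (f := Subtype.val) ((hfin a).subset ?_)
      Subtype.val_injective.injOn
    rintro _ ⟨b, hb, rfl⟩
    exact ⟨b.2, hb⟩
  let _ : LocallyFiniteOrder ι :=
    LocallyFiniteOrder.ofFiniteIcc fun a b => (hfinι b).subset Icc_subset_Iic_self
  have : Infinite ι := hinf.to_subtype
  have : NoMaxOrder ι := ⟨fun a => by
    by_contra! h
    exact Set.infinite_univ ((hfinι a).subset fun b _ => not_lt.1 (h b))⟩
  obtain ⟨b, hb⟩ : ∃ b : ι, ∀ a, b ≤ a := by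
    obtain ⟨a⟩ := (inferInstance : Nonempty ι)
    obtain ⟨b, hb, hb'⟩ := (hfinι a).exists_minimal ⟨a, le_refl a⟩
    refine ⟨b, fun c => ?_⟩
    rcases le_total b c with h | h
    · exact h
    · exact hb' (h.trans hb) h
  let _ : OrderBot ι := { bot := b, bot_le := hb }
  let _ : SuccOrder ι := LinearLocallyFiniteOrder.succOrder ι
  let _ : PredOrder ι := LinearLocallyFiniteOrder.predOrder ι
  let iso : ι ≃o ℕ := orderIsoNatOfLinearSuccPredArch
  choose e he hn hr using fun l : ι => l.2.exists_real_normalized hq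
  refine ⟨fun n => iso.symm n, fun n => ⟨e (iso.symm n),
    mem_testSpace_of_eigen (isEigenpair_iff.1 (he _)).2⟩, ?_, fun n => he _, ?_, fun n => hn _,
    fun n => hr _⟩
  · exact fun m n h => iso.symm.strictMono h
  · exact fun l hl => ⟨iso ⟨l, hl⟩, by simp⟩

end Spectral

/-! ### The orthonormal basis of eigenfunctions -/

section Basis

variable {q : ℝ → ℝ} {lam : ℕ → ℝ} {φ : ℕ → testSpace q}

theorem IsEigensystem.orthonormal (hq : MemLp q ∞ mu01) (h : IsEigensystem q lam φ) :
    Orthonormal ℂ (fun n => (φ n : L2)) :=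
  ⟨h.normalized, fun _ _ hmn =>
    inner_eigen_eq_zero hq (h.strictMono.injective.ne hmn) (h.eigenpair _) (h.eigenpair _)⟩

theorem IsEigensystem.pos (hpos : ∀ l : ℝ, IsEigenvalue q l → 0 < l) (h : IsEigensystem q lam φ)
    (n : ℕ) : 0 < lam n := hpos _ ⟨_, h.eigenpair n⟩

/-- Every eigenpair is a multiple of a member of the eigensystem. -/
theorem IsEigensystem.exists_smul (hq : MemLp q ∞ mu01) (h : IsEigensystem q lam φ) {l : ℝ}
    {e : L2} (he : IsEigenpair q l e) : ∃ n, ∃ c : ℂ, l = lam n ∧ e = c • (φ n : L2) := by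
  obtain ⟨n, rfl⟩ := h.exhaustive l ⟨e, he⟩
  obtain ⟨c, hc⟩ := exists_smul_eq_of_eigen hq (h.eigenpair n) (isEigenpair_iff.1 he).2
  exact ⟨n, c, rfl, hc⟩

/-- The orthonormal basis of `L²(0,1)` formed by an eigensystem. -/
noncomputable def IsEigensystem.basis (hq : MemLp q ∞ mu01)
    (hpos : ∀ l : ℝ, IsEigenvalue q l → 0 < l) (h : IsEigensystem q lam φ) :
    HilbertBasis ℕ ℂ L2 :=
  HilbertBasis.mkOfOrthogonalEqBot (h.orthonormal hq) (by
    rw [Submodule.eq_bot_iff]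
    intro f hf
    refine eq_zero_of_inner_eigen hq hpos fun l e he => ?_
    obtain ⟨n, c, -, rfl⟩ := h.exists_smul hq he
    exact hf _ (Submodule.smul_mem _ _ (Submodule.subset_span ⟨n, rfl⟩)))

theorem IsEigensystem.basis_apply (hq : MemLp q ∞ mu01)
    (hpos : ∀ l : ℝ, IsEigenvalue q l → 0 < l) (h : IsEigensystem q lam φ) (n : ℕ) :
    h.basis hq hpos n = φ n := by
  rw [basis, HilbertBasis.coe_mkOfOrthogonalEqBot]

end Basis

theorem norm_sum_smul_sq_of_orthonormal {ι E : Type*} [NormedAddCommGroup E]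
    [InnerProductSpace ℂ E] {v : ι → E} (hv : Orthonormal ℂ v) (c : ι → ℂ) (s : Finset ι) :
    ‖∑ i ∈ s, c i • v i‖ ^ 2 = ∑ i ∈ s, ‖c i‖ ^ 2 := by
  have h1 := hv.inner_sum c c s
  rw [inner_self_eq_norm_sq_to_K] at h1
  have h2 : ((‖∑ i ∈ s, c i • v i‖ ^ 2 : ℝ) : ℂ) = ((∑ i ∈ s, ‖c i‖ ^ 2 : ℝ) : ℂ) := by
    push_cast
    refine Eq.trans h1 (Finset.sum_congr rfl fun i _ => ?_)
    rw [← Complex.normSq_eq_conj_mul_self, Complex.normSq_eq_norm_sq, Complex.ofReal_pow]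
  exact_mod_cast h2

/-! ### Distributions and fractional powers in terms of coefficients -/

/-- The iterates of `𝓛` on test functions, as linear maps into `L²(0,1)`. -/
noncomputable def iterL (q : ℝ → ℝ) (j : ℕ) : testSpace q →ₗ[ℂ] L2 where
  toFun ψ := (slApply q)^[j] (ψ : L2)
  map_add' ψ χ := slApply_iterate_add q ψ.2 χ.2 j
  map_smul' c ψ := slApply_iterate_smul q c ψ.2 j

theorem iterL_apply {q : ℝ → ℝ} (j : ℕ) (ψ : testSpace q) :
    iterL q j ψ = (slApply q)^[j] (ψ : L2) := rfl

theorem norm_iterL_le_testNorm {q : ℝ → ℝ} {j m : ℕ} (h : j ≤ m) (ψ : testSpace q) :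
    ‖iterL q j ψ‖ ≤ testNorm q m ψ :=
  Finset.le_sup' (fun j => ‖(slApply q)^[j] (ψ : L2)‖) (Finset.mem_range.2 (Nat.lt_succ_of_le h))

theorem testNorm_le {q : ℝ → ℝ} {m : ℕ} {ψ : testSpace q} {B : ℝ}
    (h : ∀ j ≤ m, ‖iterL q j ψ‖ ≤ B) : testNorm q m ψ ≤ B :=
  Finset.sup'_le _ _ fun j hj => h j (Nat.le_of_lt_succ (Finset.mem_range.1 hj))

theorem ofL2_apply (q : ℝ → ℝ) (f : L2) (ψ : testSpace q) :
    (ofL2 q f).1 ψ = ∫ x, f x * (ψ : L2) x ∂mu01 := rfl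

/-- The duality pairing is bilinear, while `inner` is conjugate linear in its first argument. -/
theorem ofL2_apply_eq_inner (q : ℝ → ℝ) (f : L2) (ψ : testSpace q) :
    (ofL2 q f).1 ψ = inner ℂ (star f) (ψ : L2) := by
  rw [ofL2_apply, L2.inner_def]
  apply integral_congr_ae
  filter_upwards [Lp.coeFn_star f] with x hx
  rw [hx]
  simp [mul_comm]

theorem L2_norm_star (f : L2) : ‖star f‖ = ‖f‖ := by
  rw [Lp.norm_def, Lp.norm_def]
  congr 1
  apply eLpNorm_congr_norm_ae
  filter_upwards [Lp.coeFn_star f] with x hx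
  rw [hx, Pi.star_apply, norm_star]

theorem ofL2_sub (q : ℝ → ℝ) (f g : L2) : ofL2 q (f - g) = ofL2 q f - ofL2 q g := by
  apply Subtype.ext
  apply LinearMap.ext
  intro ψ
  change (ofL2 q (f - g)).1 ψ = (ofL2 q f).1 ψ - (ofL2 q g).1 ψ
  rw [ofL2_apply_eq_inner, ofL2_apply_eq_inner, ofL2_apply_eq_inner, L2_star_sub, inner_sub_left]

namespace IsEigensystem

variable {q : ℝ → ℝ} {lam : ℕ → ℝ} {φ : ℕ → testSpace q} (h : IsEigensystem q lam φ)
include h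

theorem mem_slGraph (n : ℕ) : ((φ n : L2), (lam n : ℂ) • (φ n : L2)) ∈ slGraph q :=
  (isEigenpair_iff.1 (h.eigenpair n)).2

theorem iterL_eigen (j n : ℕ) : iterL q j (φ n) = (lam n : ℂ) ^ j • (φ n : L2) :=
  slApply_iterate_eigen (h.mem_slGraph n) j

/-- Because the eigenfunctions are real, distributional and Hilbert space coefficients agree. -/
theorem ofL2_apply_eigen (f : L2) (n : ℕ) : (ofL2 q f).1 (φ n) = inner ℂ (φ n : L2) f := by
  rw [ofL2_apply, L2.inner_def]
  apply integral_congr_ae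
  filter_upwards [h.real_valued n] with x hx
  rw [RCLike.inner_apply, Complex.conj_eq_iff_im.2 hx]

/-- The square roots of the eigenvalues of `𝓛^s`. -/
theorem sqrt_rpow_eq (hpos : ∀ l : ℝ, IsEigenvalue q l → 0 < l) (s : ℝ) (n : ℕ) :
    √(lam n ^ s) = lam n ^ (s / 2) := by
  rw [Real.sqrt_eq_rpow, ← Real.rpow_mul (h.pos hpos n).le, mul_one_div]

variable (hq : MemLp q ∞ mu01)
include hq

theorem inner_iterL (j n : ℕ) (ψ : testSpace q) :
    inner ℂ (φ n : L2) (iterL q j ψ) = (lam n : ℂ) ^ j * inner ℂ (φ n : L2) (ψ : L2) := by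
  induction j with
  | zero => simp [iterL_apply]
  | succ j ih =>
    have h1 := inner_slGraph_comm hq (h.mem_slGraph n) (slApply_mem_slGraph (ψ.2 j))
    rw [iterL_apply, Function.iterate_succ_apply']
    change inner ℂ ((lam n : ℂ) • (φ n : L2)) _ = inner ℂ (φ n : L2) _ at h1
    rw [← h1, inner_smul_left, Complex.conj_ofReal]
    rw [iterL_apply] at ih
    rw [ih]
    ring

/-- By simplicity every eigenfunction is a multiple of some `φ n`, so fractional powers may be
tested on one eigensystem only. -/
theorem isFracPow_iff {r : ℝ} {ω η : LDistribution q} :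
    IsFracPow q r ω η ↔ ∀ n, η.1 (φ n) = ((lam n ^ r : ℝ) : ℂ) * ω.1 (φ n) := by
  constructor
  · exact fun H n => H (lam n) (φ n) (h.eigenpair n)
  · intro H l e he
    obtain ⟨n, c, rfl, hc⟩ := h.exists_smul hq he
    have hc' : e = c • φ n := Subtype.ext hc
    rw [hc', map_smul, map_smul, H n, smul_eq_mul, smul_eq_mul]
    ring

variable (hpos : ∀ l : ℝ, IsEigenvalue q l → 0 < l)
include hpos

theorem hasSum_inner_smul (f : L2) :
    HasSum (fun n => (inner ℂ (φ n : L2) f : ℂ) • (φ n : L2)) f := by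
  have := (h.basis hq hpos).hasSum_repr f
  simpa only [HilbertBasis.repr_apply_apply, h.basis_apply hq hpos] using this

theorem ext_inner {f g : L2} (hfg : ∀ n, inner ℂ (φ n : L2) f = inner ℂ (φ n : L2) g) : f = g := by
  have h1 := h.hasSum_inner_smul hq hpos f
  simp only [hfg] at h1
  exact h1.unique (h.hasSum_inner_smul hq hpos g)

theorem hasSum_norm_sq (f : L2) : HasSum (fun n => ‖inner ℂ (φ n : L2) f‖ ^ 2) (‖f‖ ^ 2) := by
  have h1 := (h.basis hq hpos).hasSum_inner_mul_inner f f
  simp only [h.basis_apply hq hpos] at h1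
  have h2 := Complex.hasSum_re h1
  rw [inner_self_eq_norm_sq_to_K] at h2
  convert! h2 using 1
  · ext n
    rw [← inner_conj_symm f, ← Complex.normSq_eq_conj_mul_self, Complex.ofReal_re,
      Complex.normSq_eq_norm_sq]
  · exact (Complex.ofReal_re _).symm.trans (by rw [Complex.ofReal_pow]; rfl)

theorem exists_of_summable {c : ℕ → ℂ} (hc : Summable fun n => ‖c n‖ ^ 2) :
    ∃ f : L2, ∀ n, inner ℂ (φ n : L2) f = c n := by
  have hmem : Memℓp c 2 := by
    rw [memℓp_gen_iff (by norm_num)]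
    simpa using hc
  refine ⟨(h.basis hq hpos).repr.symm ⟨c, hmem⟩, fun n => ?_⟩
  rw [← h.basis_apply hq hpos, ← HilbertBasis.repr_apply_apply,
    LinearIsometryEquiv.apply_symm_apply]

theorem exists_of_le {c : ℕ → ℂ} {K : ℝ} {f : L2}
    (hc : ∀ n, ‖c n‖ ≤ K * ‖inner ℂ (φ n : L2) f‖) :
    ∃ g : L2, ∀ n, inner ℂ (φ n : L2) g = c n := by
  refine h.exists_of_summable hq hpos (Summable.of_nonneg_of_le (fun n => by positivity)
    (fun n => ?_) ((h.hasSum_norm_sq hq hpos f).summable.mul_left (K ^ 2)))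
  rw [← mul_pow]
  exact pow_le_pow_left₀ (norm_nonneg _) (hc n) 2

theorem norm_le_of_le {f g : L2}
    (hc : ∀ n, ‖inner ℂ (φ n : L2) f‖ ≤ ‖inner ℂ (φ n : L2) g‖) : ‖f‖ ≤ ‖g‖ := by
  have := hasSum_le (fun n => pow_le_pow_left₀ (norm_nonneg _) (hc n) 2)
    (h.hasSum_norm_sq hq hpos f) (h.hasSum_norm_sq hq hpos g)
  exact le_of_sq_le_sq this (norm_nonneg _)

theorem hasSum_ofL2 (f : L2) (ψ : testSpace q) :
    HasSum (fun n => inner ℂ (φ n : L2) f * inner ℂ (φ n : L2) (ψ : L2)) ((ofL2 q f).1 ψ) := by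
  have h1 := (h.basis hq hpos).hasSum_inner_mul_inner (star f) (ψ : L2)
  simp only [h.basis_apply hq hpos, ← ofL2_apply_eq_inner, h.ofL2_apply_eigen] at h1
  exact h1

/-- A distribution is the sum of its eigenfunction expansion. -/
theorem hasSum_distribution (ω : LDistribution q) (ψ : testSpace q) :
    HasSum (fun n => inner ℂ (φ n : L2) (ψ : L2) * ω.1 (φ n)) (ω.1 ψ) := by
  obtain ⟨C, m, hC, hω⟩ := ω.2
  rw [HasSum, tendsto_iff_norm_sub_tendsto_zero]
  -- Symmetry makes each `𝓛^j` commute with the partial sums, so the expansion of `ψ` converges in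
  -- all test norms and the continuity of `ω` applies.
  have h0 : ∀ j, Tendsto (fun s : Finset ℕ => ‖iterL q j
      (∑ n ∈ s, (inner ℂ (φ n : L2) (ψ : L2) : ℂ) • φ n - ψ)‖) atTop (𝓝 0) := fun j => by
    have h1 := h.hasSum_inner_smul hq hpos (iterL q j ψ)
    rw [HasSum, tendsto_iff_norm_sub_tendsto_zero] at h1
    refine h1.congr fun s => ?_
    rw [map_sub, map_sum]
    congr 2
    refine Finset.sum_congr rfl fun n _ => ?_
    rw [map_smul, h.iterL_eigen, h.inner_iterL hq, smul_smul, mul_comm]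
  refine squeeze_zero (fun _ => norm_nonneg _) (g := fun s : Finset ℕ =>
    C * ∑ j ∈ Finset.range (m + 1), ‖iterL q j
      (∑ n ∈ s, (inner ℂ (φ n : L2) (ψ : L2) : ℂ) • φ n - ψ)‖) (fun s => ?_) ?_
  · have h2 : ∑ n ∈ s, inner ℂ (φ n : L2) (ψ : L2) * ω.1 (φ n) - ω.1 ψ =
        ω.1 (∑ n ∈ s, (inner ℂ (φ n : L2) (ψ : L2) : ℂ) • φ n - ψ) := by
      rw [map_sub, map_sum]
      simp only [map_smul, smul_eq_mul]
    rw [h2]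
    refine (hω _).trans (mul_le_mul_of_nonneg_left (testNorm_le fun j hj => ?_) hC)
    exact Finset.single_le_sum (f := fun j => ‖iterL q j
      (∑ n ∈ s, (inner ℂ (φ n : L2) (ψ : L2) : ℂ) • φ n - ψ)‖) (fun _ _ => norm_nonneg _)
      (Finset.mem_range.2 (Nat.lt_succ_of_le hj))
  · have := (tendsto_finsetSum (Finset.range (m + 1)) fun j _ => h0 j).const_mul C
    simpa using this

theorem ext_distribution {ω η : LDistribution q} (hωη : ∀ n, ω.1 (φ n) = η.1 (φ n)) : ω = η := by
  apply Subtype.ext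
  apply LinearMap.ext
  intro ψ
  have h1 := h.hasSum_distribution hq hpos ω ψ
  simp only [hωη] at h1
  exact h1.unique (h.hasSum_distribution hq hpos η ψ)

theorem ofL2_injective : Function.Injective (ofL2 q) := fun f g hfg =>
  h.ext_inner hq hpos fun n => by rw [← h.ofL2_apply_eigen, hfg, h.ofL2_apply_eigen]

theorem l2Norm_ofL2 (f : L2) : l2Norm q (ofL2 q f) = ‖f‖ := by
  have hex : ∃ g : L2, ofL2 q g = ofL2 q f := ⟨f, rfl⟩
  rw [l2Norm, dif_pos hex, h.ofL2_injective hq hpos hex.choose_spec]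

/-- The coefficients of a distribution grow at most polynomially, in mean square. -/
theorem exists_representative (ω : LDistribution q) :
    ∃ (m : ℕ) (f : L2), ∀ n, inner ℂ (φ n : L2) f = (((1 + lam n) ^ m)⁻¹ : ℝ) * ω.1 (φ n) := by
  obtain ⟨C, m, hC, hω⟩ := ω.2
  refine ⟨m, h.exists_of_summable hq hpos (summable_of_sum_le (c := C ^ 2)
    (fun n => by positivity) fun s => ?_)⟩
  set w : ℕ → ℝ := fun n => ((1 + lam n) ^ m)⁻¹ with hw
  have hlam : ∀ n, 0 < lam n := h.pos hpos
  have hwpos : ∀ n, 0 < w n := fun n => by have := hlam n; positivity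
  set S := ∑ n ∈ s, ‖((w n : ℝ) : ℂ) * ω.1 (φ n)‖ ^ 2 with hS
  have hS0 : 0 ≤ S := Finset.sum_nonneg fun n _ => by positivity
  -- A duality choice: the test function `ψ` below satisfies `ω ψ = S`, while its norms up to order
  -- `m` are at most `√S`. Continuity of `ω` then gives `S ≤ C √S`, a bound independent of `s`.
  set c : ℕ → ℂ := fun n => ((w n ^ 2 : ℝ) : ℂ) * star (ω.1 (φ n)) with hc
  set ψ : testSpace q := ∑ n ∈ s, c n • φ n with hψ
  have h1 : ω.1 ψ = S := by
    rw [hψ, map_sum, hS, Complex.ofReal_sum]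
    refine Finset.sum_congr rfl fun n _ => ?_
    rw [map_smul, smul_eq_mul, hc, mul_assoc, Complex.star_def, ← Complex.normSq_eq_conj_mul_self,
      Complex.normSq_eq_norm_sq, norm_mul, mul_pow, Complex.norm_real, Real.norm_eq_abs, sq_abs]
    push_cast
    ring
  have h2 : ∀ j ≤ m, ‖iterL q j ψ‖ ≤ √S := fun j hj => by
    rw [hψ, map_sum]
    simp only [map_smul, h.iterL_eigen, smul_smul]
    refine Real.le_sqrt_of_sq_le ?_
    rw [norm_sum_smul_sq_of_orthonormal (h.orthonormal hq), hS]
    refine Finset.sum_le_sum fun n _ => pow_le_pow_left₀ (norm_nonneg _) ?_ 2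
    have h4 : w n * lam n ^ j ≤ 1 := by
      rw [hw, inv_mul_le_one₀ (by have := hlam n; positivity)]
      calc lam n ^ j ≤ (1 + lam n) ^ j := pow_le_pow_left₀ (hlam n).le (by linarith) j
        _ ≤ (1 + lam n) ^ m := pow_le_pow_right₀ (by linarith [hlam n]) hj
    have h5 : 0 ≤ ‖ω.1 (φ n)‖ := norm_nonneg _
    rw [hc, norm_mul, norm_mul, norm_mul, norm_pow, Complex.norm_real, Complex.norm_real,
      Complex.norm_real, norm_star, Real.norm_of_nonneg (hwpos n).le,
      Real.norm_of_nonneg (hlam n).le, Real.norm_of_nonneg (by have := hwpos n; positivity)]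
    calc w n ^ 2 * ‖ω.1 (φ n)‖ * lam n ^ j = (w n * ‖ω.1 (φ n)‖) * (w n * lam n ^ j) := by ring
      _ ≤ (w n * ‖ω.1 (φ n)‖) * 1 := by
        have := hwpos n
        gcongr
      _ = w n * ‖ω.1 (φ n)‖ := mul_one _
  have h3 : S ≤ C * √S := by
    have := (hω ψ).trans (mul_le_mul_of_nonneg_left (testNorm_le h2) hC)
    rwa [h1, Complex.norm_real, Real.norm_of_nonneg hS0] at this
  by_cases hz : S = 0
  · rw [hz]; positivity
  · have h4 : 0 < √S := Real.sqrt_pos.2 (lt_of_le_of_ne hS0 (Ne.symm hz))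
    have h5 : √S * √S = S := Real.mul_self_sqrt hS0
    have h6 : √S ≤ C := le_of_mul_le_mul_right (by linarith) h4
    nlinarith

/-- The functional is `ψ ↦ ∫ g (ψ + 𝓛^N ψ)`, where `g ∈ L²` has coefficients `λ^r ω(φ n) / (1 +
λ^N)`. Taking `N` large makes them square summable by `exists_representative`. Consequently the
default value in `fracPow` never occurs. -/
theorem exists_isFracPow (r : ℝ) (ω : LDistribution q) : ∃ η, IsFracPow q r ω η := by
  obtain ⟨m, f, hf⟩ := h.exists_representative hq hpos ω
  have hlam : ∀ n, 0 < lam n := h.pos hpos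
  -- For `r ≥ 0` the power `k` absorbs `λ^r`; for `r ≤ 0` the bound `λ_n^r ≤ λ_0^r` suffices, and `1
  -- + λ_0^r` covers both cases. The factor `2 ^ N` in `κ` comes from `(1 + λ)^N ≤ 2^N (1 + λ^N)`.
  set k := ⌈r⌉₊ with hk
  set N := m + k with hN
  set κ := (1 + lam 0 ^ r) * 2 ^ N with hκ
  have hrow : ∀ n, lam n ^ r ≤ (1 + lam 0 ^ r) * (1 + lam n) ^ k := fun n => by
    have h0 : 0 < lam 0 ^ r := Real.rpow_pos_of_pos (hlam 0) r
    have h1 : 1 ≤ (1 + lam n) ^ k := one_le_pow₀ (by linarith [hlam n])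
    rcases le_total 0 r with hr | hr
    · calc lam n ^ r ≤ (1 + lam n) ^ r :=
            Real.rpow_le_rpow (hlam n).le (by linarith) hr
        _ ≤ (1 + lam n) ^ (k : ℝ) :=
            Real.rpow_le_rpow_of_exponent_le (by linarith [hlam n]) (Nat.le_ceil r)
        _ = 1 * (1 + lam n) ^ k := by rw [Real.rpow_natCast, one_mul]
        _ ≤ _ := by gcongr; linarith
    · calc lam n ^ r ≤ lam 0 ^ r :=
            Real.rpow_le_rpow_of_nonpos (hlam 0) (h.strictMono.monotone (Nat.zero_le n)) hr
        _ ≤ (1 + lam 0 ^ r) * 1 := by linarith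
        _ ≤ _ := by gcongr
  obtain ⟨g, hg⟩ := h.exists_of_le hq hpos (f := f) (K := κ)
    (c := fun n => ((lam n ^ r * (1 + lam n ^ N)⁻¹ : ℝ) : ℂ) * ω.1 (φ n)) (fun n => by
      have hl := hlam n
      have hr0 : 0 < lam n ^ r := Real.rpow_pos_of_pos hl r
      have h2 : (1 + lam n) ^ N ≤ 2 ^ N * (1 + lam n ^ N) := by
        refine (add_pow_le zero_le_one hl.le N).trans ?_
        rw [one_pow]
        gcongr
        · norm_num
        · omega
      rw [hf, norm_mul, norm_mul, Complex.norm_real, Complex.norm_real,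
        Real.norm_of_nonneg (by positivity), Real.norm_of_nonneg (by positivity), ← mul_assoc]
      refine mul_le_mul_of_nonneg_right ?_ (norm_nonneg _)
      rw [← div_eq_mul_inv, ← div_eq_mul_inv, div_le_div_iff₀ (by positivity) (by positivity)]
      calc lam n ^ r * (1 + lam n) ^ m
          ≤ (1 + lam 0 ^ r) * (1 + lam n) ^ k * (1 + lam n) ^ m := by gcongr; exact hrow n
        _ = (1 + lam 0 ^ r) * (1 + lam n) ^ N := by rw [hN, pow_add]; ring
        _ ≤ (1 + lam 0 ^ r) * (2 ^ N * (1 + lam n ^ N)) := by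
            have := Real.rpow_pos_of_pos (hlam 0) r
            gcongr
        _ = κ * (1 + lam n ^ N) := by rw [hκ]; ring)
  refine ⟨⟨(innerSL ℂ (star g) : L2 →ₗ[ℂ] ℂ) ∘ₗ (iterL q 0 + iterL q N),
    2 * ‖g‖, N, by positivity, fun ψ => ?_⟩, (h.isFracPow_iff hq).2 fun n => ?_⟩
  · change ‖inner ℂ (star g) (iterL q 0 ψ + iterL q N ψ)‖ ≤ _
    have h1 := norm_iterL_le_testNorm (Nat.zero_le N) ψ
    have h2 := norm_iterL_le_testNorm (le_refl N) ψ
    calc ‖inner ℂ (star g) (iterL q 0 ψ + iterL q N ψ)‖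
        ≤ ‖star g‖ * ‖iterL q 0 ψ + iterL q N ψ‖ := norm_inner_le_norm _ _
      _ ≤ ‖g‖ * (testNorm q N ψ + testNorm q N ψ) := by
          rw [L2_norm_star]
          gcongr
          exact (norm_add_le _ _).trans (add_le_add h1 h2)
      _ = 2 * ‖g‖ * testNorm q N ψ := by ring
  · change inner ℂ (star g) (iterL q 0 (φ n) + iterL q N (φ n)) = _
    have hl := hlam n
    have h3 : ((1 + lam n ^ N : ℝ) : ℂ) ≠ 0 := by
      exact_mod_cast (by positivity : (1 + lam n ^ N : ℝ) ≠ 0)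
    rw [h.iterL_eigen, h.iterL_eigen, pow_zero, ← add_smul, inner_smul_right,
      ← ofL2_apply_eq_inner, h.ofL2_apply_eigen, hg]
    push_cast at h3 ⊢
    field_simp

theorem fracPow_apply_eigen (r : ℝ) (ω : LDistribution q) (n : ℕ) :
    (fracPow q r ω).1 (φ n) = ((lam n ^ r : ℝ) : ℂ) * ω.1 (φ n) := by
  have hex := h.exists_isFracPow hq hpos r ω
  rw [fracPow, dif_pos hex]
  exact (h.isFracPow_iff hq).1 hex.choose_spec n

theorem ofL2_eq_fracPow_iff {r : ℝ} {ω : LDistribution q} {f : L2} :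
    ofL2 q f = fracPow q r ω ↔
      ∀ n, inner ℂ (φ n : L2) f = ((lam n ^ r : ℝ) : ℂ) * ω.1 (φ n) := by
  constructor
  · intro H n
    rw [← h.ofL2_apply_eigen, H, h.fracPow_apply_eigen hq hpos]
  · intro H
    refine h.ext_distribution hq hpos fun n => ?_
    rw [h.ofL2_apply_eigen, H, h.fracPow_apply_eigen hq hpos]

theorem sobolevNorm_eq {s : ℝ} {ω : LDistribution q} {f : L2}
    (hf : ∀ n, inner ℂ (φ n : L2) f = ((lam n ^ (s / 2) : ℝ) : ℂ) * ω.1 (φ n)) :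
    sobolevNorm q s ω = ‖f‖ := by
  rw [sobolevNorm, ← (h.ofL2_eq_fracPow_iff hq hpos).2 hf, h.l2Norm_ofL2 hq hpos]

end IsEigensystem

/-! ### Diagonal time-dependent families in `L²(0,1)` -/

namespace IsEigensystem

variable {q : ℝ → ℝ} {lam : ℕ → ℝ} {φ : ℕ → testSpace q} (h : IsEigensystem q lam φ)
  (hq : MemLp q ∞ mu01) (hpos : ∀ l : ℝ, IsEigenvalue q l → 0 < l)
include h hq hpos

/-- Strongly continuous families of contractions that are diagonal in the eigenbasis. -/
theorem exists_multiplier {m : ℕ → ℝ → ℝ} (hm : ∀ n, Continuous (m n))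
    (hm1 : ∀ n t, |m n t| ≤ 1) (f : L2) :
    ∃ g : ℝ → L2, Continuous g ∧
      (∀ t n, inner ℂ (φ n : L2) (g t) = (m n t : ℂ) * inner ℂ (φ n : L2) f) ∧
      ∀ t, ‖g t‖ ≤ ‖f‖ := by
  have hle : ∀ t n, ‖(m n t : ℂ) * inner ℂ (φ n : L2) f‖ ≤ 1 * ‖inner ℂ (φ n : L2) f‖ :=
    fun t n => by
      rw [norm_mul, Complex.norm_real, Real.norm_eq_abs]
      exact mul_le_mul_of_nonneg_right (hm1 n t) (norm_nonneg _)
  choose g hg using fun t => h.exists_of_le hq hpos (hle t)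
  refine ⟨g, ?_, hg, fun t => h.norm_le_of_le hq hpos fun n => ?_⟩
  · rw [continuous_iff_continuousAt]
    intro t
    rw [ContinuousAt, tendsto_iff_norm_sub_tendsto_zero]
    have hsq : ∀ τ, HasSum (fun n => (m n τ - m n t) ^ 2 * ‖inner ℂ (φ n : L2) f‖ ^ 2)
        (‖g τ - g t‖ ^ 2) := fun τ => by
      refine (h.hasSum_norm_sq hq hpos (g τ - g t)).congr_fun ?_
      intro n
      rw [inner_sub_right, hg, hg, ← sub_mul, norm_mul, ← Complex.ofReal_sub, Complex.norm_real,
        mul_pow, Real.norm_eq_abs, sq_abs]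
    -- Dominated convergence for the series of squared coefficients; the factor `4` arises because
    -- two values of a multiplier differ by at most `2`.
    have h1 : Tendsto (fun τ => ∑' n, (m n τ - m n t) ^ 2 * ‖inner ℂ (φ n : L2) f‖ ^ 2) (𝓝 t)
        (𝓝 (∑' n, (0 : ℝ) * ‖inner ℂ (φ n : L2) f‖ ^ 2)) := by
      refine tendsto_tsum_of_dominated_convergence
        (bound := fun n => 4 * ‖inner ℂ (φ n : L2) f‖ ^ 2)
        ((h.hasSum_norm_sq hq hpos f).summable.mul_left 4) (fun n => ?_)
        (Eventually.of_forall fun τ n => ?_)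
      · have h2 : Tendsto (fun τ => (m n τ - m n t) ^ 2) (𝓝 t) (𝓝 ((m n t - m n t) ^ 2)) :=
          (((hm n).tendsto t).sub_const _).pow 2
        rw [sub_self, zero_pow two_ne_zero] at h2
        exact h2.mul_const _
      · rw [norm_mul, norm_pow, norm_pow, norm_norm, Real.norm_eq_abs]
        refine mul_le_mul_of_nonneg_right ?_ (by positivity)
        have h3 : |m n τ - m n t| ≤ 2 := by
          have := abs_sub (m n τ) (m n t)
          linarith [hm1 n τ, hm1 n t]
        nlinarith [abs_nonneg (m n τ - m n t)]
    simp only [zero_mul, tsum_zero, (hsq _).tsum_eq] at h1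
    have h4 := (Real.continuous_sqrt.tendsto 0).comp h1
    simpa [Function.comp_def, Real.sqrt_sq (norm_nonneg _)] using h4
  · rw [hg]
    simpa using hle t n

/-- Comparing coefficients gives `u t = u 0 + ∫ v` in `L²`, and `v` is continuous in norm.
Coefficientwise differentiability thus becomes norm differentiability without estimating difference
quotients. -/
theorem hasDerivAt_of_coeff {u v : ℝ → L2} (hv : Continuous v)
    (huv : ∀ n t, HasDerivAt (fun τ => (inner ℂ (φ n : L2) (u τ) : ℂ)) (inner ℂ (φ n : L2) (v t)) t)
    (t : ℝ) : HasDerivAt u (v t) t := by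
  have hu : u = fun t => u 0 + ∫ τ in (0 : ℝ)..t, v τ := by
    ext1 t
    refine h.ext_inner hq hpos fun n => ?_
    have h1 := (innerSL ℂ (φ n : L2)).intervalIntegral_comp_comm
      (hv.intervalIntegrable (μ := volume) 0 t)
    simp only [innerSL_apply_apply] at h1
    rw [inner_add_right, ← h1,
      intervalIntegral.integral_eq_sub_of_hasDerivAt (fun x _ => huv n x)
        ((continuous_const.inner hv).intervalIntegrable 0 t)]
    ring
  rw [hu]
  exact ((hv.integral_hasStrictDerivAt 0 t).hasDerivAt).const_add (u 0)

end IsEigensystem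

/-! ### Harmonic oscillators and uniqueness -/

theorem hasDerivAt_cos_add_sin (a b : ℂ) (ω t : ℝ) :
    HasDerivAt (fun τ : ℝ => (Real.cos (ω * τ) : ℂ) * a + (Real.sin (ω * τ) : ℂ) * b)
      ((ω : ℂ) * (-(Real.sin (ω * t) : ℂ) * a + (Real.cos (ω * t) : ℂ) * b)) t := by
  have h1 : HasDerivAt (fun τ : ℝ => ω * τ) ω t := by simpa using (hasDerivAt_id t).const_mul ω
  have hc := ((Real.hasDerivAt_cos (ω * t)).comp t h1).ofReal_comp
  have hs := ((Real.hasDerivAt_sin (ω * t)).comp t h1).ofReal_comp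
  convert! (hc.mul_const a).add (hs.mul_const b) using 1
  push_cast
  ring

/-- Uniqueness for the harmonic oscillator on `[0,T]`. -/
theorem oscillator_unique {T ω : ℝ} (hT : 0 < T) {z z' : ℝ → ℂ}
    (hz : ∀ t ∈ Icc 0 T, HasDerivWithinAt z (z' t) (Icc 0 T) t)
    (hz' : ∀ t ∈ Icc 0 T, HasDerivWithinAt z' (-((ω : ℂ) ^ 2 * z t)) (Icc 0 T) t) :
    ∀ t ∈ Icc 0 T, (ω : ℂ) * z t =
      (Real.cos (ω * t) : ℂ) * (ω * z 0) + (Real.sin (ω * t) : ℂ) * z' 0 := by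
  have hd : ∀ t : ℝ, HasDerivAt (fun τ : ℝ => ω * τ) ω t := fun t => by
    simpa using (hasDerivAt_id t).const_mul ω
  have hc : ∀ t, HasDerivWithinAt (fun τ : ℝ => (Real.cos (ω * τ) : ℂ))
      (-(Real.sin (ω * t) : ℂ) * ω) (Icc 0 T) t := fun t => by
    have := ((Real.hasDerivAt_cos (ω * t)).comp t (hd t)).ofReal_comp.hasDerivWithinAt
      (s := Icc 0 T)
    push_cast at this
    simpa [Function.comp_def] using this
  have hs : ∀ t, HasDerivWithinAt (fun τ : ℝ => (Real.sin (ω * τ) : ℂ))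
      ((Real.cos (ω * t) : ℂ) * ω) (Icc 0 T) t := fun t => by
    have := ((Real.hasDerivAt_sin (ω * t)).comp t (hd t)).ofReal_comp.hasDerivWithinAt
      (s := Icc 0 T)
    push_cast at this
    simpa [Function.comp_def] using this
  have hconst : ∀ {p : ℝ → ℂ}, (∀ t ∈ Icc 0 T, HasDerivWithinAt p 0 (Icc 0 T) t) →
      ∀ t ∈ Icc 0 T, p t = p 0 := fun {p} hp =>
    constant_of_derivWithin_zero (fun t ht => (hp t ht).differentiableWithinAt)
      (fun t ht => (hp t (Ico_subset_Icc_self ht)).derivWithin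
        (uniqueDiffOn_Icc hT t (Ico_subset_Icc_self ht)))
  -- The two components of `(z', ω z)` in coordinates rotating with angle `ω t` are constant;
  -- eliminating `z'` between them gives the formula for `ω z`.
  have hp := hconst (p := fun t => z' t * (Real.cos (ω * t) : ℂ) +
      (ω * z t) * (Real.sin (ω * t) : ℂ)) fun t ht => by
    convert! ((hz' t ht).mul (hc t)).add (((hz t ht).const_mul (ω : ℂ)).mul (hs t)) using 1
    ring
  have hr := hconst (p := fun t => z' t * (Real.sin (ω * t) : ℂ) -
      (ω * z t) * (Real.cos (ω * t) : ℂ)) fun t ht => by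
    convert! ((hz' t ht).mul (hs t)).sub (((hz t ht).const_mul (ω : ℂ)).mul (hc t)) using 1
    ring
  intro t ht
  have h1 := hp t ht
  have h2 := hr t ht
  simp only [mul_zero, Real.cos_zero, Real.sin_zero, Complex.ofReal_one, Complex.ofReal_zero,
    mul_one, add_zero, zero_sub] at h1 h2
  have h3 : (Real.cos (ω * t) : ℂ) ^ 2 + (Real.sin (ω * t) : ℂ) ^ 2 = 1 := by
    exact_mod_cast Real.cos_sq_add_sin_sq (ω * t)
  linear_combination (Real.sin (ω * t) : ℂ) * h1 - (Real.cos (ω * t) : ℂ) * h2 - ω * z t * h3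

namespace IsEigensystem

variable {q : ℝ → ℝ} {lam : ℕ → ℝ} {φ : ℕ → testSpace q} (h : IsEigensystem q lam φ)
  (hq : MemLp q ∞ mu01) (hpos : ∀ l : ℝ, IsEigenvalue q l → 0 < l)
include h hq hpos

/-- Testing the equation on `φ n` leaves an oscillator of frequency `√(lam n ^ s)`, so the data
determine each coefficient. -/
theorem coeff_of_isSolution {s T : ℝ} (hT : 0 < T) {u₀ : LDistribution q} {u₁ : L2} {v : ℝ → L2}
    (hv : IsSolution q s T u₀ u₁ v) (n : ℕ) {t : ℝ} (ht : t ∈ Icc 0 T) :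
    ((√(lam n ^ s) : ℝ) : ℂ) * inner ℂ (φ n : L2) (v t) =
      (Real.cos (√(lam n ^ s) * t) : ℂ) * (((√(lam n ^ s) : ℝ) : ℂ) * u₀.1 (φ n)) +
        (Real.sin (√(lam n ^ s) * t) : ℂ) * inner ℂ (φ n : L2) u₁ := by
  have hz : ∀ t ∈ Icc 0 T, HasDerivWithinAt (fun τ => (inner ℂ (φ n : L2) (v τ) : ℂ))
      (inner ℂ (φ n : L2) (timeDeriv T v t)) (Icc 0 T) t := fun t ht => by
    have h1 := (hv.contDiff_L2.differentiableOn one_ne_zero t ht).hasDerivWithinAt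
    exact ((innerSL ℂ (φ n : L2)).restrictScalars ℝ).hasFDerivAt.comp_hasDerivWithinAt t h1
  have hz' : ∀ t ∈ Icc 0 T, HasDerivWithinAt
      (fun τ => (inner ℂ (φ n : L2) (timeDeriv T v τ) : ℂ))
      (-(((√(lam n ^ s) : ℝ) : ℂ) ^ 2 * inner ℂ (φ n : L2) (v t))) (Icc 0 T) t := fun t ht => by
    have h1 := hv.equation (φ n) t ht
    simp only [h.fracPow_apply_eigen hq hpos, h.ofL2_apply_eigen] at h1
    rwa [← Complex.ofReal_pow, Real.sq_sqrt (Real.rpow_nonneg (h.pos hpos n).le s)]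
  have key := oscillator_unique hT hz hz' t ht
  rwa [hv.initial_deriv, ← h.ofL2_apply_eigen (v 0), hv.initial] at key

theorem isSolution_unique {s T : ℝ} (hT : 0 < T) {u₀ : LDistribution q} {u₁ : L2} {u v : ℝ → L2}
    (hu : IsSolution q s T u₀ u₁ u) (hv : IsSolution q s T u₀ u₁ v) : EqOn v u (Icc 0 T) :=
  fun t ht => h.ext_inner hq hpos fun n => by
    have h1 := h.coeff_of_isSolution hq hpos hT hu n ht
    rw [← h.coeff_of_isSolution hq hpos hT hv n ht] at h1
    have h2 : ((√(lam n ^ s) : ℝ) : ℂ) ≠ 0 := by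
      exact_mod_cast (Real.sqrt_pos.2 (Real.rpow_pos_of_pos (h.pos hpos n) s)).ne'
    exact (mul_left_cancel₀ h2 h1).symm

/-! ### Existence and the estimates -/

/-- The growth `λ^(s/2) ≤ 1 + λ^k` is absorbed by the test function, since `λ^k ⟨φ n, ψ⟩` are the
coefficients of `𝓛^k ψ`. The series dominates the derivative of `⟨u_t, ψ⟩` term by term. -/
theorem summable_sqrt_mul_inner {s : ℝ} (hs : 0 ≤ s) (f g : L2) (ψ : testSpace q) :
    Summable fun n => √(lam n ^ s) * (‖inner ℂ (φ n : L2) f‖ + ‖inner ℂ (φ n : L2) g‖) *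
      ‖inner ℂ (φ n : L2) (ψ : L2)‖ := by
  set k := ⌈s / 2⌉₊ with hk
  have hsum := ((h.hasSum_norm_sq hq hpos f).add (h.hasSum_norm_sq hq hpos g)).add
    ((h.hasSum_norm_sq hq hpos (ψ : L2)).add (h.hasSum_norm_sq hq hpos (iterL q k ψ)))
  refine Summable.of_nonneg_of_le (fun n => by positivity) (fun n => ?_) hsum.summable
  have hl := h.pos hpos n
  have h1 : √(lam n ^ s) ≤ 1 + lam n ^ k := by
    rw [h.sqrt_rpow_eq hpos]
    rcases le_total 1 (lam n) with h1 | h1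
    · calc lam n ^ (s / 2) ≤ lam n ^ (k : ℝ) := Real.rpow_le_rpow_of_exponent_le h1 (Nat.le_ceil _)
        _ = lam n ^ k := Real.rpow_natCast _ _
        _ ≤ _ := by linarith
    · have h2 : lam n ^ (s / 2) ≤ 1 := Real.rpow_le_one hl.le h1 (by linarith)
      have h3 : 0 ≤ lam n ^ k := by positivity
      linarith
  rw [h.inner_iterL hq, norm_mul, norm_pow, Complex.norm_real, Real.norm_of_nonneg hl.le]
  set a := ‖inner ℂ (φ n : L2) f‖
  set b := ‖inner ℂ (φ n : L2) g‖
  set c := ‖inner ℂ (φ n : L2) (ψ : L2)‖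
  have ha : 0 ≤ a := norm_nonneg _
  have hb : 0 ≤ b := norm_nonneg _
  have hc : 0 ≤ c := norm_nonneg _
  calc √(lam n ^ s) * (a + b) * c ≤ (1 + lam n ^ k) * (a + b) * c := by gcongr
    _ = (a + b) * (c + lam n ^ k * c) := by ring
    _ ≤ a ^ 2 + b ^ 2 + (c ^ 2 + (lam n ^ k * c) ^ 2) := by
      nlinarith [sq_nonneg (a - c), sq_nonneg (b - c), sq_nonneg (a - lam n ^ k * c),
        sq_nonneg (b - lam n ^ k * c)]

/-- The solution of the Cauchy problem, apart from its boundary values. -/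
theorem exists_solution {s T : ℝ} (hs : 0 ≤ s) (hT : 0 < T) {u₀ : LDistribution q} {u₁ : L2}
    (hu₀ : u₀ ∈ sobolevSpace q s)
    (hbd : 1 / 2 < s → ∀ f : L2, ofL2 q f ∈ sobolevSpace q s → ∃ y : ℝ → ℂ,
      ContinuousOn y (Icc 0 1) ∧ (f : ℝ → ℂ) =ᵐ[mu01] y ∧ y 0 = 0 ∧ y 1 = 0) :
    ∃ u : ℝ → L2, IsSolution q s T u₀ u₁ u ∧
      (∀ t n, inner ℂ (φ n : L2) (u t) =
        u₀.1 (φ n) * (Real.cos (√(lam n ^ s) * t) : ℂ) +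
          1 / ((√(lam n ^ s) : ℝ) : ℂ) * (ofL2 q u₁).1 (φ n) *
            (Real.sin (√(lam n ^ s) * t) : ℂ)) ∧
      ∀ t ∈ Icc 0 T,
        ‖u t‖ ≤ l2Norm q u₀ + sobolevNorm q (-s) (ofL2 q u₁) ∧
        sobolevNorm q s (ofL2 q (u t)) ≤ sobolevNorm q s u₀ + ‖u₁‖ ∧
        ‖timeDeriv T u t‖ ≤ sobolevNorm q s u₀ + ‖u₁‖ := by
  obtain ⟨f, hf⟩ := hu₀
  rw [h.ofL2_eq_fracPow_iff hq hpos] at hf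
  set ω : ℕ → ℝ := fun n => √(lam n ^ s) with hω
  have hω' : ∀ n, lam n ^ (s / 2) = ω n := fun n => (h.sqrt_rpow_eq hpos s n).symm
  have hωpos : ∀ n, 0 < ω n := fun n =>
    Real.sqrt_pos.2 (Real.rpow_pos_of_pos (h.pos hpos n) s)
  have hωC : ∀ n, (ω n : ℂ) ≠ 0 := fun n => by exact_mod_cast (hωpos n).ne'
  have hωmono : ∀ n, ω 0 ≤ ω n := fun n => Real.sqrt_le_sqrt
    (Real.rpow_le_rpow (h.pos hpos 0).le (h.strictMono.monotone (Nat.zero_le n)) hs)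
  simp only [hω'] at hf
  -- Dividing by the frequencies is bounded because they are at least `ω 0 > 0`; this uses `s ≥ 0`.
  have hinv : ∀ g : L2, ∃ g' : L2, ∀ n,
      inner ℂ (φ n : L2) g' = (ω n : ℂ)⁻¹ * inner ℂ (φ n : L2) g := fun g =>
    h.exists_of_le hq hpos (f := g) (K := (ω 0)⁻¹) fun n => by
      rw [norm_mul, norm_inv, Complex.norm_real, Real.norm_of_nonneg (hωpos n).le]
      exact mul_le_mul_of_nonneg_right (inv_anti₀ (hωpos 0) (hωmono n)) (norm_nonneg _)
  have hcos := h.exists_multiplier hq hpos (m := fun n t => Real.cos (ω n * t))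
    (fun n => by fun_prop) (fun n t => Real.abs_cos_le_one _)
  have hsin := h.exists_multiplier hq hpos (m := fun n t => Real.sin (ω n * t))
    (fun n => by fun_prop) (fun n t => Real.abs_sin_le_one _)
  obtain ⟨f', hf'⟩ := hinv f
  obtain ⟨u₁', hu₁'⟩ := hinv u₁
  have hf'' : ∀ n, inner ℂ (φ n : L2) f' = u₀.1 (φ n) := fun n => by
    rw [hf', hf, inv_mul_cancel_left₀ (hωC n)]
  obtain ⟨cf, hcf, hcf1, hcf2⟩ := hcos f
  obtain ⟨sf, hsf, hsf1, hsf2⟩ := hsin f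
  obtain ⟨c1, hc1, hc11, hc12⟩ := hcos u₁
  obtain ⟨s1, hs1, hs11, hs12⟩ := hsin u₁
  obtain ⟨cf', hcf', hcf1', hcf2'⟩ := hcos f'
  obtain ⟨s1', hs1', hs11', hs12'⟩ := hsin u₁'
  -- Here `v` will be `u_t` and `w` will be `𝓛^(s/2) u`. Building both from `f = 𝓛^(s/2) u₀` and
  -- `u₁` keeps all multipliers bounded by `1`.
  set u : ℝ → L2 := fun t => cf' t + s1' t with hu
  set v : ℝ → L2 := fun t => c1 t - sf t with hv
  set w : ℝ → L2 := fun t => cf t + s1 t with hw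
  have hun : ∀ t n, inner ℂ (φ n : L2) (u t) = (Real.cos (ω n * t) : ℂ) * u₀.1 (φ n) +
      (Real.sin (ω n * t) : ℂ) * ((ω n : ℂ)⁻¹ * inner ℂ (φ n : L2) u₁) := fun t n => by
    rw [hu, inner_add_right, hcf1', hs11', hf'', hu₁']
  have hvn : ∀ t n, inner ℂ (φ n : L2) (v t) = (ω n : ℂ) *
      (-(Real.sin (ω n * t) : ℂ) * u₀.1 (φ n) +
        (Real.cos (ω n * t) : ℂ) * ((ω n : ℂ)⁻¹ * inner ℂ (φ n : L2) u₁)) := fun t n => by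
    have := hωC n
    rw [hv, inner_sub_right, hc11, hsf1, hf]
    field_simp
    ring
  have hwn : ∀ t n, inner ℂ (φ n : L2) (w t) = (ω n : ℂ) * inner ℂ (φ n : L2) (u t) :=
    fun t n => by
      have := hωC n
      rw [hw, hun, inner_add_right, hcf1, hs11, hf]
      field_simp
  have hvc : Continuous v := hc1.sub hsf
  have hwc : Continuous w := hcf.add hs1
  have hud : ∀ t, HasDerivAt u (v t) t := h.hasDerivAt_of_coeff hq hpos hvc fun n t => by
    simp only [hun, hvn]
    exact hasDerivAt_cos_add_sin _ _ _ _
  have htd : ∀ t ∈ Icc 0 T, timeDeriv T u t = v t := fun t ht =>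
    (hud t).hasDerivWithinAt.derivWithin (uniqueDiffOn_Icc hT t ht)
  have hws : ∀ t, ofL2 q (w t) = fracPow q (s / 2) (ofL2 q (u t)) := fun t => by
    rw [h.ofL2_eq_fracPow_iff hq hpos]
    intro n
    rw [hω', h.ofL2_apply_eigen, hwn]
  have hmem : ∀ t, ofL2 q (u t) ∈ sobolevSpace q s := fun t => ⟨w t, hws t⟩
  have hnorm₀ : sobolevNorm q s u₀ = ‖f‖ := h.sobolevNorm_eq hq hpos fun n => by rw [hω', hf]
  have hinit : ofL2 q (u 0) = u₀ := h.ext_distribution hq hpos fun n => by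
    rw [h.ofL2_apply_eigen, hun]
    simp
  refine ⟨u, ⟨fun t _ => hmem t, fun t _ => ?_, ?_, fun ψ t ht => ?_, hinit, ?_,
    fun hs' t _ => hbd hs' (u t) (hmem t)⟩, fun t n => ?_, fun t ht => ⟨?_, ?_, ?_⟩⟩
  · have h1 : ∀ τ, sobolevNorm q s (ofL2 q (u τ) - ofL2 q (u t)) = ‖w τ - w t‖ := fun τ => by
      rw [← ofL2_sub]
      refine h.sobolevNorm_eq hq hpos fun n => ?_
      rw [hω', h.ofL2_apply_eigen, inner_sub_right, inner_sub_right, hwn, hwn, mul_sub]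
    simp only [h1]
    exact (tendsto_iff_norm_sub_tendsto_zero.1 (hwc.tendsto t)).mono_left nhdsWithin_le_nhds
  · refine ContDiff.contDiffOn (contDiff_one_iff_deriv.2
      ⟨fun t => (hud t).differentiableAt, ?_⟩)
    rwa [show deriv u = v from funext fun t => (hud t).deriv]
  · set ψn : ℕ → ℂ := fun n => inner ℂ (φ n : L2) (ψ : L2) with hψn
    have hvd : ∀ n t, HasDerivAt (fun τ => (inner ℂ (φ n : L2) (v τ) : ℂ) * ψn n)
        (-((ω n : ℂ) * inner ℂ (φ n : L2) (w t)) * ψn n) t := fun n t => by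
      have h1 := ((hasDerivAt_cos_add_sin (inner ℂ (φ n : L2) u₁)
        (-((ω n : ℂ) * u₀.1 (φ n))) (ω n) t)).mul_const (ψn n)
      have h2 : ∀ τ, inner ℂ (φ n : L2) (v τ) = (Real.cos (ω n * τ) : ℂ) *
          inner ℂ (φ n : L2) u₁ + (Real.sin (ω n * τ) : ℂ) * (-((ω n : ℂ) * u₀.1 (φ n))) :=
        fun τ => by
          rw [hv, inner_sub_right, hc11, hsf1, hf]
          ring
      simp only [h2]
      convert! h1 using 1
      rw [hw, inner_add_right, hcf1, hs11, hf]
      ring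
    -- For a general test function `⟨u_t, ψ⟩` is an infinite sum, differentiated termwise under the
    -- bound of `summable_sqrt_mul_inner`.
    have hsumd := hasDerivAt_tsum (h.summable_sqrt_mul_inner hq hpos hs f u₁ ψ) hvd
      (fun n t => by
        rw [norm_mul, norm_neg, norm_mul, Complex.norm_real, Real.norm_of_nonneg (hωpos n).le]
        refine mul_le_mul_of_nonneg_right (mul_le_mul_of_nonneg_left ?_ (hωpos n).le)
          (norm_nonneg _)
        rw [hw, inner_add_right, hcf1, hs11]
        refine (norm_add_le _ _).trans (add_le_add ?_ ?_)
        · rw [norm_mul, Complex.norm_real]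
          exact mul_le_of_le_one_left (norm_nonneg _) (Real.abs_cos_le_one _)
        · rw [norm_mul, Complex.norm_real]
          exact mul_le_of_le_one_left (norm_nonneg _) (Real.abs_sin_le_one _))
      (h.hasSum_ofL2 hq hpos (v 0) ψ).summable t
    have h1 : ∀ τ, ∑' n, (inner ℂ (φ n : L2) (v τ) : ℂ) * ψn n = (ofL2 q (v τ)).1 ψ := fun τ =>
      (h.hasSum_ofL2 hq hpos (v τ) ψ).tsum_eq
    have h2 : ∑' n, -((ω n : ℂ) * inner ℂ (φ n : L2) (w t)) * ψn n =
        -((fracPow q s (ofL2 q (u t))).1 ψ) := by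
      rw [← (h.hasSum_distribution hq hpos (fracPow q s (ofL2 q (u t))) ψ).tsum_eq, ← tsum_neg]
      refine tsum_congr fun n => ?_
      rw [h.fracPow_apply_eigen hq hpos, h.ofL2_apply_eigen, hwn,
        ← Real.sq_sqrt (Real.rpow_nonneg (h.pos hpos n).le s), Complex.ofReal_pow]
      ring
    simp only [h1] at hsumd
    rw [h2] at hsumd
    exact hsumd.hasDerivWithinAt.congr (fun τ hτ => by rw [htd τ hτ]) (by rw [htd t ht])
  · rw [htd 0 (left_mem_Icc.2 hT.le)]
    refine h.ext_inner hq hpos fun n => ?_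
    rw [hv, inner_sub_right, hc11, hsf1]
    simp
  · rw [hun, h.ofL2_apply_eigen]
    ring
  · rw [← hinit, h.l2Norm_ofL2 hq hpos, h.sobolevNorm_eq hq hpos (f := u₁') fun n => by
      rw [hu₁', h.ofL2_apply_eigen, neg_div, Real.rpow_neg (h.pos hpos n).le, hω',
        Complex.ofReal_inv]]
    have h0 : u 0 = f' := h.ext_inner hq hpos fun n => by
      rw [hun, hf'']
      simp
    rw [h0]
    exact (norm_add_le _ _).trans (add_le_add (hcf2' t) (hs12' t))
  · rw [h.sobolevNorm_eq hq hpos (f := w t) fun n => by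
      rw [hω', h.ofL2_apply_eigen, hwn], hnorm₀]
    exact (norm_add_le _ _).trans (add_le_add (hcf2 t) (hs12 t))
  · rw [htd t ht, hnorm₀, add_comm]
    exact (norm_sub_le _ _).trans (add_le_add (hc12 t) (hsf2 t))

end IsEigensystem

/-! ### Continuous representatives and boundary values -/

/-- A bound for the continuous representative of an element of the domain of `𝓛`. -/
theorem exists_continuous_representative {q : ℝ → ℝ} (hq : MemLp q ∞ mu01) {f g : L2}
    (hfg : (f, g) ∈ slGraph q) {a : ℝ} (ha : 1 ≤ a)
    (hg : (inner ℂ f g).re ≤ 2 * a ^ 4 * ‖f‖ ^ 2) :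
    ∃ y : ℝ → ℂ, ContinuousOn y (Icc 0 1) ∧ (f : ℝ → ℂ) =ᵐ[mu01] y ∧ y 0 = 0 ∧ y 1 = 0 ∧
      ∀ x ∈ Icc (0 : ℝ) 1, ‖y x‖ ≤ (1 + √(2 + ‖potential hq‖)) * a * ‖f‖ := by
  have hE := norm_greenDeriv_sq_le hq hfg
  rw [mem_slGraph_iff hq] at hfg
  set F := g - potential hq f
  set M := ‖potential hq‖
  have hM : 0 ≤ M := norm_nonneg _
  have ha0 : 0 < a := zero_lt_one.trans_le ha
  have hw : ‖greenDeriv F‖ ≤ √(2 + M) * (a ^ 2 * ‖f‖) := by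
    refine le_of_sq_le_sq ?_ (by positivity)
    rw [mul_pow, Real.sq_sqrt (by positivity)]
    have h1 : 1 ≤ a ^ 4 := one_le_pow₀ ha
    have h2 : M * ‖f‖ ^ 2 ≤ M * ‖f‖ ^ 2 * a ^ 4 := le_mul_of_one_le_right (by positivity) h1
    nlinarith
  refine ⟨prim (greenDeriv F), continuousOn_prim _, ?_, prim_zero_right _, prim_greenDeriv_one F,
    fun x hx => ?_⟩
  · have := green_coeFn F
    rwa [← hfg] at this
  -- Since `‖y'‖` is at most a constant times `a ^ 2 * ‖f‖`, the window `δ = a⁻²` makes both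
  -- interpolation terms of order `a * ‖f‖`.
  · have hδ : (a⁻¹) ^ 2 ≤ 1 := pow_le_one₀ (by positivity) (inv_le_one_of_one_le₀ ha)
    have h1 := norm_prim_le_interpolation (greenDeriv F) hx (δ := (a⁻¹) ^ 2) (by positivity) hδ
    rw [Real.sqrt_sq (by positivity), ← green_apply, ← hfg] at h1
    have h2 : a ^ 2 * ((a⁻¹) ^ 2 * ‖prim (greenDeriv F) x‖) ≤
        a ^ 2 * (a⁻¹ * ‖f‖ + (a⁻¹) ^ 2 * (a⁻¹ * (√(2 + M) * (a ^ 2 * ‖f‖)))) := by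
      gcongr
      exact h1.trans (by gcongr)
    have h3 : a ^ 2 * ((a⁻¹) ^ 2 * ‖prim (greenDeriv F) x‖) = ‖prim (greenDeriv F) x‖ := by
      field_simp
    have h4 : a ^ 2 * (a⁻¹ * ‖f‖ + (a⁻¹) ^ 2 * (a⁻¹ * (√(2 + M) * (a ^ 2 * ‖f‖)))) =
        (1 + √(2 + M)) * a * ‖f‖ := by
      field_simp
    linarith

/-- Uniform limits of continuous representatives. -/
theorem exists_representative_of_hasSum {f : L2} {u : ℕ → L2} (hu : HasSum u f) {y : ℕ → ℝ → ℂ}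
    {c : ℕ → ℝ} (hc : Summable c) (hy : ∀ k, ContinuousOn (y k) (Icc 0 1))
    (huy : ∀ k, (u k : ℝ → ℂ) =ᵐ[mu01] y k) (hyc : ∀ k, ∀ x ∈ Icc (0 : ℝ) 1, ‖y k x‖ ≤ c k) :
    ContinuousOn (fun x => ∑' k, y k x) (Icc 0 1) ∧
      (f : ℝ → ℂ) =ᵐ[mu01] fun x => ∑' k, y k x := by
  have hcont : ContinuousOn (fun x => ∑' k, y k x) (Icc 0 1) := continuousOn_tsum hy hc hyc
  refine ⟨hcont, ?_⟩
  have hsumm : ∀ x ∈ Icc (0 : ℝ) 1, Summable fun k => y k x := fun x hx =>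
    Summable.of_norm_bounded hc fun k => hyc k x hx
  have hc0 : ∀ k, 0 ≤ c k := fun k => (norm_nonneg _).trans (hyc k 0 (by simp))
  have hmem : MemLp (fun x => ∑' k, y k x) 2 mu01 := by
    refine MemLp.of_bound (aestronglyMeasurable_mu01_of_continuousOn hcont) (∑' k, c k) ?_
    filter_upwards [ae_mem_Ioo] with x hx
    exact tsum_of_norm_bounded hc.hasSum fun k => hyc k x (Ioo_subset_Icc_self hx)
  -- The tails are uniformly small, so the partial sums converge in `L²` to the pointwise sum too,
  -- and limits are unique.
  have hlim : Tendsto (fun K => ∑ k ∈ Finset.range K, u k) atTop (𝓝 (hmem.toLp _)) := by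
    rw [tendsto_iff_norm_sub_tendsto_zero]
    refine squeeze_zero (fun _ => norm_nonneg _) (fun K => ?_) (tendsto_sum_nat_add c)
    refine L2_norm_le_of_ae_bound (tsum_nonneg fun k => hc0 _) ?_
    filter_upwards [Lp.coeFn_sub (∑ k ∈ Finset.range K, u k) (hmem.toLp _), hmem.coeFn_toLp,
      Lp.coeFn_finsetSum (Finset.range K) u, ae_all_iff.2 huy, ae_mem_Ioo] with x h1 h2 h3 h4 hx
    have hx' := Ioo_subset_Icc_self hx
    rw [h1, Pi.sub_apply, h2, h3, Finset.sum_apply, Finset.sum_congr rfl fun k _ => h4 k,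
      ← (hsumm x hx').sum_add_tsum_nat_add K, sub_add_cancel_left, norm_neg]
    exact tsum_of_norm_bounded ((summable_nat_add_iff K).2 hc).hasSum fun k => hyc _ x hx'
  rw [tendsto_nhds_unique hu.tendsto_sum_nat hlim]
  exact hmem.coeFn_toLp

namespace IsEigensystem

variable {q : ℝ → ℝ} {lam : ℕ → ℝ} {φ : ℕ → testSpace q} (h : IsEigensystem q lam φ)
  (hq : MemLp q ∞ mu01)
include h hq

/-- A finite combination lies in the domain, and its quadratic form is `∑ λ_n |c_n|²`, at most the
largest eigenvalue involved times the squared norm. -/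
theorem exists_representative_finite_sum (c : ℕ → ℂ) (I : Finset ℕ) {a : ℝ} (ha : 1 ≤ a)
    (hI : ∀ n ∈ I, lam n ≤ 2 * a ^ 4) :
    ∃ y : ℝ → ℂ, ContinuousOn y (Icc 0 1) ∧
      ((∑ n ∈ I, c n • (φ n : L2) : L2) : ℝ → ℂ) =ᵐ[mu01] y ∧ y 0 = 0 ∧ y 1 = 0 ∧
      ∀ x ∈ Icc (0 : ℝ) 1, ‖y x‖ ≤
        (1 + √(2 + ‖potential hq‖)) * a * ‖∑ n ∈ I, c n • (φ n : L2)‖ := by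
  have hmem : ((∑ n ∈ I, c n • (φ n : L2), ∑ n ∈ I, (c n * lam n) • (φ n : L2)) : L2 × L2) ∈
      slGraph q := by
    have := Submodule.sum_mem (slGraph q) (t := I)
      (f := fun n => c n • ((φ n : L2), (lam n : ℂ) • (φ n : L2)))
      fun n _ => Submodule.smul_mem _ _ (h.mem_slGraph n)
    convert! this using 1
    refine Prod.ext ?_ ?_
    · rw [Prod.fst_sum]
      rfl
    · rw [Prod.snd_sum]
      simp only [Prod.smul_mk, smul_smul]
  refine exists_continuous_representative hq hmem ha ?_
  rw [norm_sum_smul_sq_of_orthonormal (h.orthonormal hq),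
    (h.orthonormal hq).inner_sum c (fun n => c n * lam n) I, Complex.re_sum, Finset.mul_sum]
  refine Finset.sum_le_sum fun n hn => ?_
  rw [← mul_assoc, ← Complex.normSq_eq_conj_mul_self, ← Complex.ofReal_mul, Complex.ofReal_re,
    Complex.normSq_eq_norm_sq, mul_comm]
  exact mul_le_mul_of_nonneg_right (hI n hn) (by positivity)

variable (hpos : ∀ l : ℝ, IsEigenvalue q l → 0 < l)
include hpos

/-- The block of eigenvalues of size `2^k` has sup norm of order `2^(k/4)` times its `L²` norm,
which is of order `2^(-ks/2)`. For `s > 1/2` the blocks converge uniformly, and zero boundary values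
survive the limit. -/
theorem exists_boundary_representative {s : ℝ} (hs : 1 / 2 < s) {f : L2}
    (hf : ofL2 q f ∈ sobolevSpace q s) :
    ∃ y : ℝ → ℂ, ContinuousOn y (Icc 0 1) ∧ (f : ℝ → ℂ) =ᵐ[mu01] y ∧ y 0 = 0 ∧ y 1 = 0 := by
  obtain ⟨w, hw⟩ := hf
  rw [h.ofL2_eq_fracPow_iff hq hpos] at hw
  simp only [h.ofL2_apply_eigen] at hw
  have hlam : ∀ n, 0 < lam n := h.pos hpos
  -- The dyadic index of `1 + λ` rather than `λ`, so that small eigenvalues also receive a natural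
  -- number index.
  set κ : ℕ → ℕ := fun n => Nat.log 2 ⌊1 + lam n⌋₊ with hκ
  have hfloor : ∀ n, 1 ≤ ⌊1 + lam n⌋₊ := fun n => Nat.le_floor (by
    rw [Nat.cast_one]; linarith [hlam n])
  have hκ1 : ∀ n, (2 : ℝ) ^ κ n ≤ 1 + lam n := fun n => by
    have h1 : 2 ^ κ n ≤ ⌊1 + lam n⌋₊ := Nat.pow_log_le_self 2 (by have := hfloor n; omega)
    calc (2 : ℝ) ^ κ n ≤ (⌊1 + lam n⌋₊ : ℝ) := by exact_mod_cast h1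
      _ ≤ 1 + lam n := Nat.floor_le (by linarith [hlam n])
  have hκ2 : ∀ n, lam n ≤ 2 * (2 : ℝ) ^ κ n := fun n => by
    have h1 : ⌊1 + lam n⌋₊ + 1 ≤ 2 ^ (κ n + 1) := Nat.lt_pow_succ_log_self one_lt_two _
    have h2 : (⌊1 + lam n⌋₊ : ℝ) + 1 ≤ (2 : ℝ) ^ (κ n + 1) := by exact_mod_cast h1
    have h3 := Nat.lt_floor_add_one (1 + lam n)
    rw [pow_succ] at h2
    linarith
  have hfin : ∀ k, (κ ⁻¹' {k}).Finite := fun k => by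
    refine Finite.of_finite_image (f := lam) ((finite_eigenvalues_le hq hpos (2 * 2 ^ k)).subset ?_)
      h.strictMono.injective.injOn
    rintro _ ⟨n, rfl, rfl⟩
    exact ⟨⟨_, h.eigenpair n⟩, hκ2 n⟩
  set I : ℕ → Finset ℕ := fun k => (hfin k).toFinset with hI
  have hmemI : ∀ {k n}, n ∈ I k → κ n = k := fun {k n} hn => by simpa [hI] using hn
  set c : ℕ → ℂ := fun n => inner ℂ (φ n : L2) f with hc
  set u : ℕ → L2 := fun k => ∑ n ∈ I k, c n • (φ n : L2) with hu
  have hsum : HasSum u f := by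
    have h1 := (h.hasSum_inner_smul hq hpos f).tsum_fiberwise κ
    convert! h1 using 1
    ext1 k
    have h2 := Finset.tsum_subtype' (I k) fun n => (inner ℂ (φ n : L2) f : ℂ) • (φ n : L2)
    rw [(hfin k).coe_toFinset] at h2
    exact h2.symm
  -- With `a = ρ ^ k` one has `2 * a ^ 4 = 2 * 2 ^ k`, the upper bound for eigenvalues in block `k`.
  set ρ : ℝ := (2 : ℝ) ^ (1 / 4 : ℝ) with hρ
  have hρ1 : 1 ≤ ρ := Real.one_le_rpow one_le_two (by norm_num)
  have hρ4 : ∀ k : ℕ, (ρ ^ k) ^ 4 = 2 ^ k := fun k => by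
    have h1 : ρ ^ 4 = 2 := by
      rw [hρ, ← Real.rpow_natCast, ← Real.rpow_mul zero_le_two]
      norm_num
    rw [← pow_mul, mul_comm, pow_mul, h1]
  choose y hy1 hy2 hy3 hy4 hy5 using fun k => h.exists_representative_finite_sum hq c (I k)
    (a := ρ ^ k) (one_le_pow₀ hρ1) (fun n hn => by
      rw [hρ4, ← hmemI hn]; exact hκ2 n)
  -- Since `x / (1 + x)` is increasing, `λ_n ≥ b (1 + λ_n) ≥ b 2^(κ n)`: a lower bound valid also
  -- when the first eigenvalue is small.
  set b := lam 0 / (1 + lam 0) with hb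
  have hbpos : 0 < b := div_pos (hlam 0) (by linarith [hlam 0])
  have hblam : ∀ n, b * 2 ^ κ n ≤ lam n := fun n => by
    refine (mul_le_mul_of_nonneg_left (hκ1 n) hbpos.le).trans ?_
    have := h.strictMono.monotone (Nat.zero_le n)
    rw [hb, div_mul_eq_mul_div, div_le_iff₀ (by linarith [hlam 0])]
    linarith
  set r : ℝ := (2 : ℝ) ^ (-(s / 2)) with hr
  have hrpos : 0 < r := by positivity
  have hunorm : ∀ k, ‖u k‖ ≤ b ^ (-(s / 2)) * r ^ k * ‖w‖ := fun k => by
    refine le_of_sq_le_sq ?_ (by positivity)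
    rw [hu, norm_sum_smul_sq_of_orthonormal (h.orthonormal hq), mul_pow]
    calc ∑ n ∈ I k, ‖c n‖ ^ 2
        ≤ ∑ n ∈ I k, (b ^ (-(s / 2)) * r ^ k) ^ 2 * ‖inner ℂ (φ n : L2) w‖ ^ 2 := by
          refine Finset.sum_le_sum fun n hn => ?_
          rw [← mul_pow]
          refine pow_le_pow_left₀ (norm_nonneg _) ?_ 2
          have h1 : lam n ^ (-(s / 2)) ≤ b ^ (-(s / 2)) * r ^ k := by
            rw [← hmemI hn]
            calc lam n ^ (-(s / 2)) ≤ (b * 2 ^ κ n) ^ (-(s / 2)) :=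
                  Real.rpow_le_rpow_of_nonpos (by positivity) (hblam n) (by linarith)
              _ = _ := by
                rw [Real.mul_rpow hbpos.le (by positivity), hr, ← Real.rpow_natCast,
                  ← Real.rpow_natCast, ← Real.rpow_mul zero_le_two, ← Real.rpow_mul zero_le_two,
                  mul_comm (κ n : ℝ)]
          have h2 : ‖c n‖ = lam n ^ (-(s / 2)) * ‖inner ℂ (φ n : L2) w‖ := by
            have h3 : 0 < lam n ^ (s / 2) := Real.rpow_pos_of_pos (hlam n) _
            rw [hw, norm_mul, Complex.norm_real, Real.norm_of_nonneg h3.le,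
              Real.rpow_neg (hlam n).le, inv_mul_cancel_left₀ h3.ne']
          rw [h2]
          gcongr
      _ = (b ^ (-(s / 2)) * r ^ k) ^ 2 * ∑ n ∈ I k, ‖inner ℂ (φ n : L2) w‖ ^ 2 := by
          rw [Finset.mul_sum]
      _ ≤ _ := by
          gcongr
          exact sum_le_hasSum _ (fun n _ => by positivity) (h.hasSum_norm_sq hq hpos w)
  -- The ratio is `2^(1/4 - s/2)`, which is where `s > 1/2` is decisive.
  have hρr : ρ * r < 1 := by
    rw [hρ, hr, ← Real.rpow_add two_pos]
    exact Real.rpow_lt_one_of_one_lt_of_neg one_lt_two (by linarith)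
  set B := 1 + √(2 + ‖potential hq‖) with hB
  have hsummable : Summable fun k : ℕ => B * b ^ (-(s / 2)) * ‖w‖ * (ρ * r) ^ k :=
    (summable_geometric_of_lt_one (by positivity) hρr).mul_left _
  have hbound : ∀ k, ∀ x ∈ Icc (0 : ℝ) 1,
      ‖y k x‖ ≤ B * b ^ (-(s / 2)) * ‖w‖ * (ρ * r) ^ k := fun k x hx => by
    calc ‖y k x‖ ≤ B * ρ ^ k * ‖u k‖ := hy5 k x hx
      _ ≤ B * ρ ^ k * (b ^ (-(s / 2)) * r ^ k * ‖w‖) := by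
          gcongr
          exact hunorm k
      _ = _ := by rw [mul_pow]; ring
  obtain ⟨hY1, hY2⟩ := exists_representative_of_hasSum hsum hsummable hy1 hy2 hbound
  exact ⟨_, hY1, hY2, by simp [hy3], by simp [hy4]⟩

end IsEigensystem

end SturmLiouville

theorem mainTheorem1 (s T : ℝ) (hs : 0 ≤ s) (hT : 0 < T) :
    ∃ C : ℝ, 0 < C ∧
      ∀ q : ℝ → ℝ, MemLp q ∞ SturmLiouville.mu01 →
        (∀ l : ℝ, SturmLiouville.IsEigenvalue q l → 0 < l) →
        (∃ (lam : ℕ → ℝ) (φ : ℕ → SturmLiouville.testSpace q),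
          SturmLiouville.IsEigensystem q lam φ) ∧
        ∀ (u₀ : SturmLiouville.LDistribution q) (u₁ : SturmLiouville.L2),
          u₀ ∈ SturmLiouville.sobolevSpace q s →
          ∃ u : ℝ → SturmLiouville.L2,
            SturmLiouville.IsSolution q s T u₀ u₁ u ∧
            (∀ v : ℝ → SturmLiouville.L2, SturmLiouville.IsSolution q s T u₀ u₁ v →
              EqOn v u (Icc 0 T)) ∧
            (∀ (lam : ℕ → ℝ) (φ : ℕ → SturmLiouville.testSpace q),
              SturmLiouville.IsEigensystem q lam φ → ∀ t ∈ Icc 0 T,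
                HasSum (fun n : ℕ =>
                  (u₀.1 (φ n) * (Real.cos (√(lam n ^ s) * t) : ℂ) +
                    1 / ((√(lam n ^ s) : ℝ) : ℂ) * (SturmLiouville.ofL2 q u₁).1 (φ n) *
                      (Real.sin (√(lam n ^ s) * t) : ℂ)) • (φ n : SturmLiouville.L2)) (u t)) ∧
            ∀ t ∈ Icc 0 T,
              ‖u t‖ ≤ C * (SturmLiouville.l2Norm q u₀ +
                SturmLiouville.sobolevNorm q (-s) (SturmLiouville.ofL2 q u₁)) ∧
              SturmLiouville.sobolevNorm q s (SturmLiouville.ofL2 q (u t)) ≤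
                C * (SturmLiouville.sobolevNorm q s u₀ + ‖u₁‖) ∧
              ‖SturmLiouville.timeDeriv T u t‖ ≤
                C * (SturmLiouville.sobolevNorm q s u₀ + ‖u₁‖) := by
  -- The constant is `1` because sine and cosine are bounded by `1`.
  refine ⟨1, one_pos, fun q hq hpos => ?_⟩
  have hex := SturmLiouville.exists_eigensystem hq hpos
  refine ⟨hex, fun u₀ u₁ hu₀ => ?_⟩
  have hsol := fun (lam : ℕ → ℝ) (φ : ℕ → SturmLiouville.testSpace q)
      (h : SturmLiouville.IsEigensystem q lam φ) =>
    h.exists_solution hq hpos hs hT hu₀ (u₁ := u₁) fun hs' _ hf =>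
      h.exists_boundary_representative hq hpos hs' hf
  obtain ⟨lam, φ, h⟩ := hex
  obtain ⟨u, hu, -, hbound⟩ := hsol lam φ h
  refine ⟨u, hu, fun v hv => h.isSolution_unique hq hpos hT hu hv,
    fun lam' φ' h' t ht => ?_, fun t ht => ?_⟩
  -- The expansion is needed for every eigensystem: the solution built from another one has the
  -- required coefficients and coincides with `u` by uniqueness.
  · obtain ⟨u', hu', hcoeff, -⟩ := hsol lam' φ' h'
    rw [h.isSolution_unique hq hpos hT hu' hu ht]
    have hsum := h'.hasSum_inner_smul hq hpos (u' t)
    simp only [hcoeff] at hsum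
    exact hsum
  · simpa only [one_mul] using hbound t ht
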